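/- Let $k$ be a commutative artinian ring. Let $Q$ be a locally finite quiver (every vertex is the source or target of only finitely many arrows), and let $kQ$ be the $k$-category of paths of $Q$: its objects are the vertices and $(kQ)(v,w)$ is the free $k$-module on the paths from $v$ to $w$. Let $k^1Q$ be the ideal of $kQ$ generated by the arrows and $k^2Q:=(k^1Q)^2$. Let $I$ be an ideal of $kQ$ that is generated by a set of paths of $Q$ and is admissible, i.e. $I\subseteq k^2Q$ and for each vertex $v$ there is $l_v\in\mathbb N$ such that $I$ contains all paths of length $\ge l_v$ with source or target $v$. Put $\mathcal B:=kQ/I$. Let $\mathcal A$ be a skeletally small additive $k$-category with pseudo-kernels, i.e. for each $f\colon A'\to A$ there is $f'\colon A''\to A'$ such that $\mathcal A(-,A'')\to\mathcal A(-,A')\to\mathcal A(-,A)$ is exact. For a skeletally small $k$-category $\mathcal C$ let $\operatorname{Mod}\mathcal C$ be the category of $k$-linear functors $\mathcal C^{\mathrm{op}}\to\operatorname{Mod}k$, and $\operatorname{mod}\mathcal C$ its full subcategory of finitely presented functors, i.e. those $M$ with an exact sequence $\bigoplus_{j\in J}\mathcal C(-,C'_j)\to\bigoplus_{i\in I_0}\mathcal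 C(-,C_i)\to M\to 0$ with $I_0,J$ finite. For a $k$-category $\mathcal D$ let $\operatorname{Rep}(\mathcal B,\mathcal D)$ be the category of $k$-linear functors $\mathcal B\to\mathcal D$, and $\operatorname{rep}(\mathcal B,\mathcal D)$ its full subcategory of support-finite representations, i.e. those $R$ with $R(v)\ne0$ for only finitely many vertices $v$. The tensor product $\mathcal B^{\mathrm{op}}\otimes_k\mathcal A$ has the pairs $(v,A)$ as objects and the tensor products over $k$ of the Hom modules as Hom modules. Then the functor $\Phi\colon\operatorname{Rep}(\mathcal B,\operatorname{Mod}\mathcal A)\to\operatorname{Mod}(\mathcal B^{\mathrm{op}}\otimes_k\mathcal A)$ given by $\Phi(R)(v,A)=R(v)(A)$ and $\Phi(R)(p\otimes f)=R(p)_{A}\circ R(v)(f)$, for $p\in\mathcal B(v,w)$ and $f\in\mathcal A(A,A')$, is an equivalence, and it restricts to an equivalence $\operatorname{rep}(\mathcal B,\operatorname{mod}\mathcal A)\simeq\operatorname{mod}(\mathcal B^{\mathrm{op}}\otimes_k\mathcal A)$: there is an equivalence $\operatorname{rep}(\mathcal B,\operatorname{mod}\mathcal A)\simeq\operatorname{mod}(\mathcal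 B^{\mathrm{op}}\otimes_k\mathcal A)$ which, composed with the inclusion into $\operatorname{Mod}(\mathcal B^{\mathrm{op}}\otimes_k\mathcal A)$, is naturally isomorphic to the inclusion $\operatorname{rep}(\mathcal B,\operatorname{mod}\mathcal A)\to\operatorname{Rep}(\mathcal B,\operatorname{Mod}\mathcal A)$ followed by $\Phi$. -/

import Mathlib

open CategoryTheory CategoryTheory.Limits Opposite

open scoped TensorProduct

universe w v v' u u'

noncomputable section

/-! ### Linear categories and linear functors -/

/-- The opposite of a `k`-category is a `k`-category. -/
instance linearOpposite (k : Type w) [CommRing k] (C : Type u) [Category.{v} C]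
    [Preadditive C] [Linear k C] : Linear k Cᵒᵖ where
  homModule X Y := Equiv.module k (opEquiv X Y)
  smul_comp _ _ _ r f g := Quiver.Hom.unop_inj (Linear.comp_smul _ _ _ g.unop r f.unop)
  comp_smul _ _ _ f r g := Quiver.Hom.unop_inj (Linear.smul_comp _ _ _ r g.unop f.unop)

/-- The property of functors between `k`-categories of being `k`-linear on all Hom modules. -/
def isLinearFunctor (k : Type w) [CommRing k] (C : Type u) [Category.{v} C] [Preadditive C]
    [Linear k C] (D : Type u') [Category.{v'} D] [Preadditive D] [Linear k D] :
    ObjectProperty (C ⥤ D) :=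
  fun F => F.Additive ∧ F.Linear k

/-- `Fun_k(C, D)`: the full subcategory of the functor category consisting of the `k`-functors. -/
abbrev LinFun (k : Type w) [CommRing k] (C : Type u) [Category.{v} C] [Preadditive C]
    [Linear k C] (D : Type u') [Category.{v'} D] [Preadditive D] [Linear k D] :=
  (isLinearFunctor k C D).FullSubcategory

/-- `Mod C = Fun_k(Cᵒᵖ, Mod k)`: the category of right modules over a `k`-category `C`. -/
abbrev RightMod (k : Type w) [CommRing k] (C : Type u) [Category.{w} C] [Preadditive C]
    [Linear k C] :=
  LinFun k Cᵒᵖ (ModuleCat.{w} k)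

/-! ### Finitely presented modules -/

/-- The underlying functor of `⨁ i, C(-, A i)`, for a finite family `A` of objects. -/
def repSumFunctor (k : Type w) [CommRing k] {C : Type u} [Category.{w} C] [Preadditive C]
    [Linear k C] {n : ℕ} (A : Fin n → C) : Cᵒᵖ ⥤ ModuleCat.{w} k where
  obj X := ModuleCat.of k (∀ i : Fin n, X.unop ⟶ A i)
  map f := ModuleCat.ofHom
    (LinearMap.pi fun i : Fin n => Linear.leftComp k (A i) f.unop ∘ₗ LinearMap.proj i)
  map_id _ := ModuleCat.hom_ext (LinearMap.ext fun x => funext fun i => Category.id_comp (x i))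
  map_comp f g := ModuleCat.hom_ext (LinearMap.ext fun x => funext fun i =>
    Category.assoc g.unop f.unop (x i))

/-- The right module `⨁ i, C(-, A i)`: the finite direct sum of the representable modules
`C(-, A i)`, computed objectwise. -/
def repSum (k : Type w) [CommRing k] {C : Type u} [Category.{w} C] [Preadditive C]
    [Linear k C] {n : ℕ} (A : Fin n → C) : RightMod k C where
  obj := repSumFunctor k A
  property := by
    refine ⟨⟨?_⟩, ⟨?_⟩⟩
    · intro X Y f g
      exact ModuleCat.hom_ext (LinearMap.ext fun x => funext fun i =>
        Preadditive.add_comp _ _ _ f.unop g.unop (x i))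
    · intro X Y f r
      exact ModuleCat.hom_ext (LinearMap.ext fun x => funext fun i =>
        Linear.smul_comp _ _ _ r f.unop (x i))

/-- A right module `M` is finitely presented if there is an exact sequence
`⨁ j, C(-, A' j) ⟶ ⨁ i, C(-, A i) ⟶ M ⟶ 0` with finite index sets; exactness in
`Fun_k(Cᵒᵖ, Mod k)` is exactness at every object. -/
def isFinPres (k : Type w) [CommRing k] (C : Type u) [Category.{w} C] [Preadditive C]
    [Linear k C] : ObjectProperty (RightMod k C) :=
  fun M => ∃ (m n : ℕ) (A' : Fin m → C) (A : Fin n → C)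
    (d : repSum k A' ⟶ repSum k A) (p : repSum k A ⟶ M),
    ∀ X : Cᵒᵖ, Function.Exact (d.hom.app X).hom (p.hom.app X).hom ∧
      Function.Surjective (p.hom.app X).hom

/-- `mod C`: the full subcategory of `Mod C` of the finitely presented modules. -/
abbrev FinPresMod (k : Type w) [CommRing k] (C : Type u) [Category.{w} C] [Preadditive C]
    [Linear k C] :=
  (isFinPres k C).FullSubcategory

/-- `C` has pseudo-kernels: every `f : A' ⟶ A` admits `f' : A'' ⟶ A'` such that
`C(-, A'') ⟶ C(-, A') ⟶ C(-, A)` is exact. -/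
def HasPseudoKernels (C : Type u) [Category.{v} C] [Preadditive C] : Prop :=
  ∀ ⦃A' A : C⦄ (f : A' ⟶ A), ∃ (A'' : C) (f' : A'' ⟶ A'), ∀ X : C,
    Function.Exact (fun h : X ⟶ A'' => h ≫ f') (fun g : X ⟶ A' => g ≫ f)

/-! ### The tensor product of two `k`-categories -/

/-- The tensor product `C ⊗_k D` of two `k`-categories. Objects are pairs of objects. -/
structure TensorCat (k : Type w) (C : Type u) (D : Type u') where
  /-- the first component -/
  fst : C
  /-- the second component -/
  snd : D

namespace TensorCat

variable (k : Type w) [CommRing k] (C : Type u) [Category.{v} C] [Preadditive C] [Linear k C]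
  (D : Type u') [Category.{v'} D] [Preadditive D] [Linear k D]

/-- Hom modules are the tensor products of the Hom modules, and
`(f ⊗ g) ≫ (f' ⊗ g') = (f ≫ f') ⊗ (g ≫ g')`. -/
instance category : Category.{max v v'} (TensorCat k C D) where
  Hom X Y := (X.fst ⟶ Y.fst) ⊗[k] (X.snd ⟶ Y.snd)
  id X := 𝟙 X.fst ⊗ₜ[k] 𝟙 X.snd
  comp {X Y Z} f g := TensorProduct.map₂ (Linear.comp X.fst Y.fst Z.fst)
    (Linear.comp X.snd Y.snd Z.snd) f g
  id_comp {X Y} f := by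
    induction f using TensorProduct.induction_on with
    | zero => simp
    | tmul a b => simp
    | add a b ha hb => rw [map_add, ha, hb]
  comp_id {X Y} f := by
    induction f using TensorProduct.induction_on with
    | zero => simp
    | tmul a b => simp
    | add a b ha hb => rw [map_add, LinearMap.add_apply, ha, hb]
  assoc {W X Y Z} f g h := by
    induction f using TensorProduct.induction_on with
    | zero => simp
    | add a b ha hb => simp only [map_add, LinearMap.add_apply, ha, hb]
    | tmul a b =>
      induction g using TensorProduct.induction_on with
      | zero => simp
      | add a b ha hb => simp only [map_add, LinearMap.add_apply, ha, hb]
      | tmul a' b' =>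
        induction h using TensorProduct.induction_on with
        | zero => simp
        | add a b ha hb => simp only [map_add, ha, hb]
        | tmul a'' b'' => simp

/-- Composition in `C ⊗_k D` as a bilinear map. -/
def compBilin (X Y Z : TensorCat k C D) :
    (X.fst ⟶ Y.fst) ⊗[k] (X.snd ⟶ Y.snd) →ₗ[k] (Y.fst ⟶ Z.fst) ⊗[k] (Y.snd ⟶ Z.snd) →ₗ[k]
      (X.fst ⟶ Z.fst) ⊗[k] (X.snd ⟶ Z.snd) :=
  TensorProduct.map₂ (Linear.comp X.fst Y.fst Z.fst) (Linear.comp X.snd Y.snd Z.snd)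

variable {k C D}

/-- The morphism `f ⊗ g` of `C ⊗_k D`. -/
def homTmul {X Y : TensorCat k C D} (f : X.fst ⟶ Y.fst) (g : X.snd ⟶ Y.snd) : X ⟶ Y :=
  (f ⊗ₜ[k] g : (X.fst ⟶ Y.fst) ⊗[k] (X.snd ⟶ Y.snd))

variable (k C D)

instance preadditive : Preadditive (TensorCat k C D) where
  homGroup X Y := inferInstanceAs (AddCommGroup ((X.fst ⟶ Y.fst) ⊗[k] (X.snd ⟶ Y.snd)))
  add_comp X Y Z f f' g := LinearMap.map_add₂ (compBilin k C D X Y Z) f f' g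
  comp_add X Y Z f g g' := LinearMap.map_add (compBilin k C D X Y Z f) g g'

instance linear : Linear k (TensorCat k C D) where
  homModule X Y := inferInstanceAs (Module k ((X.fst ⟶ Y.fst) ⊗[k] (X.snd ⟶ Y.snd)))
  smul_comp X Y Z r f g := LinearMap.map_smul₂ (compBilin k C D X Y Z) r f g
  comp_smul X Y Z f r g := LinearMap.map_smul (compBilin k C D X Y Z f) r g

end TensorCat

/-! ### The comparison functor `Rep(B, Mod A) ⥤ Mod(Bᵒᵖ ⊗_k A)` -/

section Comparison

variable {k : Type w} [CommRing k] {B : Type u} [Category.{w} B] [Preadditive B] [Linear k B]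
  {A : Type u'} [Category.{w} A] [Preadditive A] [Linear k A]

/-- For `R : B ⥤ Mod A`, `S = (y, b)` and `T = (x, a)`, the linear map
`Bᵒᵖ(y, x) ⊗ A(b, a) ⟶ Hom_k(R(x)(a), R(y)(b))` sending `p ⊗ f`, with `p : x ⟶ y` in `B` and
`f : b ⟶ a` in `A`, to `R(p)_b ∘ R(x)(f)`. -/
def compareMap (R : LinFun k B (RightMod k A)) (S T : TensorCat k Bᵒᵖ A) :
    (S ⟶ T) →ₗ[k] (((R.obj.obj T.fst.unop).obj.obj (op T.snd)) ⟶
      ((R.obj.obj S.fst.unop).obj.obj (op S.snd))) :=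
  TensorProduct.lift (LinearMap.mk₂ k
    (fun (p : S.fst ⟶ T.fst) (f : S.snd ⟶ T.snd) =>
      (R.obj.obj T.fst.unop).obj.map f.op ≫ (R.obj.map p.unop).hom.app (op S.snd))
    (by
      intro p p' f
      have := R.property.1
      rw [unop_add, Functor.map_add]
      exact Preadditive.comp_add _ _ _ _ _ _)
    (by
      intro r p f
      have := R.property.2
      have h : (r • p).unop = r • p.unop := rfl
      rw [h, Functor.map_smul]
      exact Linear.comp_smul _ _ _ _ _ _)
    (by
      intro p f f'
      have := (R.obj.obj T.fst.unop).property.1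
      rw [op_add, Functor.map_add, Preadditive.add_comp])
    (by
      intro r p f
      have := (R.obj.obj T.fst.unop).property.2
      have h : (r • f).op = r • f.op := rfl
      rw [h, Functor.map_smul, Linear.smul_comp]))

lemma compareMap_tmul (R : LinFun k B (RightMod k A)) {S T : TensorCat k Bᵒᵖ A}
    (p : S.fst ⟶ T.fst) (f : S.snd ⟶ T.snd) :
    compareMap R S T (TensorCat.homTmul p f) =
      (R.obj.obj T.fst.unop).obj.map f.op ≫ (R.obj.map p.unop).hom.app (op S.snd) :=
  rfl

lemma compareMap_id (R : LinFun k B (RightMod k A)) (S : TensorCat k Bᵒᵖ A) :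
    compareMap R S S (𝟙 S) = 𝟙 _ := by
  refine (compareMap_tmul R (𝟙 S.fst) (𝟙 S.snd)).trans ?_
  rw [op_id, unop_id, CategoryTheory.Functor.map_id, CategoryTheory.Functor.map_id]
  exact Category.id_comp _

lemma compareMap_comp (R : LinFun k B (RightMod k A)) {S T U : TensorCat k Bᵒᵖ A}
    (s : S ⟶ T) (t : T ⟶ U) :
    compareMap R S U (s ≫ t) = compareMap R T U t ≫ compareMap R S T s := by
  induction s using TensorProduct.induction_on with
  | zero =>
    refine (congrArg (compareMap R S U) (zero_comp : (0 : S ⟶ T) ≫ t = 0)).trans ?_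
    refine (map_zero (compareMap R S U)).trans ?_
    refine Eq.trans ?_ (congrArg (fun z => compareMap R T U t ≫ z)
      (map_zero (compareMap R S T))).symm
    exact comp_zero.symm
  | add a b ha hb =>
    refine (congrArg (compareMap R S U) (Preadditive.add_comp S T U a b t)).trans ?_
    refine (map_add (compareMap R S U) _ _).trans ?_
    rw [ha, hb, ← Preadditive.comp_add]
    exact congrArg (fun z => compareMap R T U t ≫ z) (map_add (compareMap R S T) a b).symm
  | tmul p f =>
    induction t using TensorProduct.induction_on with
    | zero =>
      refine (congrArg (compareMap R S U) (comp_zero :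
        (TensorCat.homTmul p f : S ⟶ T) ≫ (0 : T ⟶ U) = 0)).trans ?_
      refine (map_zero (compareMap R S U)).trans ?_
      refine Eq.trans ?_ (congrArg (fun z => z ≫ compareMap R S T (TensorCat.homTmul p f))
        (map_zero (compareMap R T U))).symm
      exact zero_comp.symm
    | add a b ha hb =>
      refine (congrArg (compareMap R S U) (Preadditive.comp_add S T U
        (TensorCat.homTmul p f) a b)).trans ?_
      refine (map_add (compareMap R S U) _ _).trans ?_
      refine (congrArg₂ (· + ·) ha hb).trans ?_
      rw [← Preadditive.add_comp]
      exact congrArg (fun z => z ≫ compareMap R S T (TensorCat.homTmul p f))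
        (map_add (compareMap R T U) a b).symm
    | tmul q g =>
      change compareMap R S U (TensorCat.homTmul (p ≫ q) (f ≫ g)) =
        compareMap R T U (TensorCat.homTmul q g) ≫ compareMap R S T (TensorCat.homTmul p f)
      rw [compareMap_tmul, compareMap_tmul, compareMap_tmul, op_comp, unop_comp,
        CategoryTheory.Functor.map_comp, CategoryTheory.Functor.map_comp]
      have h := (R.obj.map q.unop).hom.naturality f.op
      simp only [Category.assoc]
      rw [← reassoc_of% h]
      rfl

/-- The right `Bᵒᵖ ⊗_k A`-module `Φ(R)`, with `Φ(R)(x, a) = R(x)(a)` and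
`Φ(R)(p ⊗ f) = R(p)_b ∘ R(x)(f)` for `p : x ⟶ y` in `B` and `f : b ⟶ a` in `A`. -/
def compareObj (R : LinFun k B (RightMod k A)) : RightMod k (TensorCat k Bᵒᵖ A) where
  obj :=
    { obj := fun T => (R.obj.obj T.unop.fst.unop).obj.obj (op T.unop.snd)
      map := fun {T S} t => compareMap R S.unop T.unop t.unop
      map_id := fun T => compareMap_id R T.unop
      map_comp := fun s t => compareMap_comp R t.unop s.unop }
  property :=
    ⟨⟨fun {T S} s t => map_add (compareMap R S.unop T.unop) s.unop t.unop⟩,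
      ⟨fun {T S} s r => map_smul (compareMap R S.unop T.unop) r s.unop⟩⟩

lemma compareMap_naturality {R R' : LinFun k B (RightMod k A)} (φ : R ⟶ R')
    {S T : TensorCat k Bᵒᵖ A} (t : S ⟶ T) :
    compareMap R S T t ≫ (φ.hom.app S.fst.unop).hom.app (op S.snd) =
      (φ.hom.app T.fst.unop).hom.app (op T.snd) ≫ compareMap R' S T t := by
  induction t using TensorProduct.induction_on with
  | zero =>
    refine (congrArg (fun z => z ≫ (φ.hom.app S.fst.unop).hom.app (op S.snd))
      (map_zero (compareMap R S T))).trans ?_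
    refine Eq.trans ?_ (congrArg (fun z => (φ.hom.app T.fst.unop).hom.app (op T.snd) ≫ z)
      (map_zero (compareMap R' S T))).symm
    exact zero_comp.trans comp_zero.symm
  | add a b ha hb =>
    refine (congrArg (fun z => z ≫ (φ.hom.app S.fst.unop).hom.app (op S.snd))
      (map_add (compareMap R S T) a b)).trans ?_
    refine Eq.trans ?_ (congrArg (fun z => (φ.hom.app T.fst.unop).hom.app (op T.snd) ≫ z)
      (map_add (compareMap R' S T) a b)).symm
    refine (Preadditive.add_comp _ _ _ _ _ _).trans ?_
    refine Eq.trans ?_ (Preadditive.comp_add _ _ _ _ _ _).symm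
    exact congrArg₂ (· + ·) ha hb
  | tmul p f =>
    change compareMap R S T (TensorCat.homTmul p f) ≫ _ =
      _ ≫ compareMap R' S T (TensorCat.homTmul p f)
    rw [compareMap_tmul, compareMap_tmul]
    have h₁ := (φ.hom.app T.fst.unop).hom.naturality f.op
    have h₂ : (R.obj.map p.unop).hom.app (op S.snd) ≫
        (φ.hom.app S.fst.unop).hom.app (op S.snd) =
        (φ.hom.app T.fst.unop).hom.app (op S.snd) ≫
          (R'.obj.map p.unop).hom.app (op S.snd) :=
      congrArg (fun z => z.hom.app (op S.snd)) (φ.hom.naturality p.unop)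
    rw [Category.assoc, h₂, reassoc_of% h₁]

/-- The functor `Φ : Rep(B, Mod A) = Fun_k(B, Mod A) ⥤ Mod(Bᵒᵖ ⊗_k A)`. -/
def compareFunctor (k : Type w) [CommRing k] (B : Type u) [Category.{w} B] [Preadditive B]
    [Linear k B] (A : Type u') [Category.{w} A] [Preadditive A] [Linear k A] :
    LinFun k B (RightMod k A) ⥤ RightMod k (TensorCat k Bᵒᵖ A) where
  obj R := compareObj R
  map φ := ObjectProperty.homMk
    { app := fun T => (φ.hom.app T.unop.fst.unop).hom.app (op T.unop.snd)
      naturality := fun _ _ t => compareMap_naturality φ t.unop }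
  map_id _ := rfl
  map_comp _ _ := rfl

end Comparison

/-! ### Ideals and residue categories of `k`-categories -/

/-- A (two-sided) ideal of a `k`-category. -/
structure LinearIdeal (k : Type w) [CommRing k] (C : Type u) [Category.{v} C] [Preadditive C]
    [Linear k C] where
  /-- the submodules of the Hom modules -/
  carrier (X Y : C) : Submodule k (X ⟶ Y)
  comp_left {X Y Z : C} (f : X ⟶ Y) {g : Y ⟶ Z} (hg : g ∈ carrier Y Z) : f ≫ g ∈ carrier X Z
  comp_right {X Y Z : C} {f : X ⟶ Y} (g : Y ⟶ Z) (hf : f ∈ carrier X Y) : f ≫ g ∈ carrier X Z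

namespace LinearIdeal

variable {k : Type w} [CommRing k] {C : Type u} [Category.{v} C] [Preadditive C] [Linear k C]

/-- The ideal generated by a family of sets of morphisms. -/
def generate (k : Type w) [CommRing k] {C : Type u} [Category.{v} C] [Preadditive C]
    [Linear k C] (S : ∀ X Y : C, Set (X ⟶ Y)) : LinearIdeal k C where
  carrier X Y := Submodule.span k
    {h | ∃ (X' Y' : C) (a : X ⟶ X') (s : X' ⟶ Y') (b : Y' ⟶ Y), s ∈ S X' Y' ∧ h = a ≫ s ≫ b}
  comp_left {X Y Z} f g hg := by
    refine Submodule.span_induction (p := fun g _ => f ≫ g ∈ _) ?_ ?_ ?_ ?_ hg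
    · rintro _ ⟨X', Y', a, s, b, hs, rfl⟩
      exact Submodule.subset_span ⟨X', Y', f ≫ a, s, b, hs, by simp⟩
    · simp
    · intro x y _ _ hx hy
      rw [Preadditive.comp_add]
      exact Submodule.add_mem _ hx hy
    · intro r x _ hx
      rw [Linear.comp_smul]
      exact Submodule.smul_mem _ r hx
  comp_right {X Y Z} f g hf := by
    refine Submodule.span_induction (p := fun f _ => f ≫ g ∈ _) ?_ ?_ ?_ ?_ hf
    · rintro _ ⟨X', Y', a, s, b, hs, rfl⟩
      exact Submodule.subset_span ⟨X', Y', a, s, b ≫ g, hs, by simp⟩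
    · simp
    · intro x y _ _ hx hy
      rw [Preadditive.add_comp]
      exact Submodule.add_mem _ hx hy
    · intro r x _ hx
      rw [Linear.smul_comp]
      exact Submodule.smul_mem _ r hx

/-- The product of two ideals: it consists of the sums of composites of a morphism of one ideal
with a morphism of the other. -/
def mul (I J : LinearIdeal k C) : LinearIdeal k C where
  carrier X Z := Submodule.span k
    {h | ∃ (Y : C) (f : X ⟶ Y) (g : Y ⟶ Z), f ∈ I.carrier X Y ∧ g ∈ J.carrier Y Z ∧ h = f ≫ g}
  comp_left {X Y Z} f g hg := by
    refine Submodule.span_induction (p := fun g _ => f ≫ g ∈ _) ?_ ?_ ?_ ?_ hg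
    · rintro _ ⟨W, a, b, ha, hb, rfl⟩
      exact Submodule.subset_span ⟨W, f ≫ a, b, I.comp_left f ha, hb, by simp⟩
    · simp
    · intro x y _ _ hx hy
      rw [Preadditive.comp_add]
      exact Submodule.add_mem _ hx hy
    · intro r x _ hx
      rw [Linear.comp_smul]
      exact Submodule.smul_mem _ r hx
  comp_right {X Y Z} f g hf := by
    refine Submodule.span_induction (p := fun f _ => f ≫ g ∈ _) ?_ ?_ ?_ ?_ hf
    · rintro _ ⟨W, a, b, ha, hb, rfl⟩
      exact Submodule.subset_span ⟨W, a, b ≫ g, ha, J.comp_right g hb, by simp⟩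
    · simp
    · intro x y _ _ hx hy
      rw [Preadditive.add_comp]
      exact Submodule.add_mem _ hx hy
    · intro r x _ hx
      rw [Linear.smul_comp]
      exact Submodule.smul_mem _ r hx

/-- Congruence modulo an ideal. -/
def rel (I : LinearIdeal k C) : HomRel C :=
  fun X Y f g => f - g ∈ I.carrier X Y

instance (I : LinearIdeal k C) : Congruence I.rel where
  equivalence :=
    { refl := fun f => by simp [rel]
      symm := fun {f g} h => by
        have h' := Submodule.neg_mem _ h
        rwa [neg_sub] at h'
      trans := fun {f g h} h₁ h₂ => by
        have h' := Submodule.add_mem _ h₁ h₂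
        rwa [sub_add_sub_cancel] at h' }
  comp_left f g g' h := by
    have h' := I.comp_left f h
    rwa [Preadditive.comp_sub] at h'
  comp_right g h := by
    have h' := I.comp_right g h
    rwa [Preadditive.sub_comp] at h'

/-- The residue category `C / I`. -/
abbrev Residue (I : LinearIdeal k C) := CategoryTheory.Quotient I.rel

lemma rel_add (I : LinearIdeal k C) ⦃X Y : C⦄ (f₁ f₂ g₁ g₂ : X ⟶ Y) (hf : I.rel f₁ f₂)
    (hg : I.rel g₁ g₂) : I.rel (f₁ + g₁) (f₂ + g₂) := by
  have h := Submodule.add_mem _ hf hg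
  rwa [sub_add_sub_comm] at h

lemma rel_smul (I : LinearIdeal k C) (r : k) ⦃X Y : C⦄ (f₁ f₂ : X ⟶ Y) (hf : I.rel f₁ f₂) :
    I.rel (r • f₁) (r • f₂) := by
  have h := Submodule.smul_mem _ r hf
  rwa [smul_sub] at h

instance (I : LinearIdeal k C) : Preadditive I.Residue :=
  CategoryTheory.Quotient.preadditive I.rel I.rel_add

instance (I : LinearIdeal k C) : (CategoryTheory.Quotient.functor I.rel).Additive :=
  CategoryTheory.Quotient.functor_additive I.rel I.rel_add

instance (I : LinearIdeal k C) : Linear k I.Residue :=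
  CategoryTheory.Quotient.linear k I.rel I.rel_smul

end LinearIdeal

/-! ### Quivers -/

/-- A quiver is locally finite if every vertex is the source or target of only finitely many
arrows. -/
def IsLocallyFiniteQuiver (Q : Type u) [Quiver.{v} Q] : Prop :=
  ∀ x : Q, Finite (Σ y : Q, (x ⟶ y)) ∧ Finite (Σ y : Q, (y ⟶ x))

/-- `kQ`: the `k`-category of paths of `Q`, whose objects are the vertices and whose Hom modules
are free on the paths. -/
abbrev PathCat (k : Type w) (Q : Type u) [Quiver.{v} Q] :=
  Free k (Paths Q)

section Quiver

variable (k : Type w) [CommRing k] {Q : Type u} [Quiver.{v} Q]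

/-- A vertex of `Q`, as an object of `kQ`. -/
def pathVertex (x : Q) : PathCat k Q :=
  (Free.embedding k (Paths Q)).obj ((Paths.of Q).obj x)

/-- A path of `Q`, as a morphism of `kQ`. -/
def pathHom {x y : Q} (p : Quiver.Path x y) : pathVertex k x ⟶ pathVertex k y :=
  (Free.embedding k (Paths Q)).map
    (show (Paths.of Q).obj x ⟶ (Paths.of Q).obj y from p)

/-- The morphisms of `kQ` given by the paths in a set `S` of paths of `Q`. -/
inductive IsPathIn (S : ∀ x y : Q, Set (Quiver.Path x y)) :
    ∀ ⦃X Y : PathCat k Q⦄, (X ⟶ Y) → Prop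
  | of {x y : Q} (p : Quiver.Path x y) (hp : p ∈ S x y) :
    IsPathIn S (X := pathVertex k x) (Y := pathVertex k y) (pathHom k p)

/-- The ideal of `kQ` generated by a set of paths of `Q`. -/
def pathIdeal (S : ∀ x y : Q, Set (Quiver.Path x y)) : LinearIdeal k (PathCat k Q) :=
  LinearIdeal.generate k fun X Y => {h : X ⟶ Y | IsPathIn k S h}

variable (Q) in
/-- `k¹Q`: the ideal of `kQ` generated by all arrows. -/
def arrowIdeal : LinearIdeal k (PathCat k Q) :=
  pathIdeal k fun x y => Set.range fun a : x ⟶ y => a.toPath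

variable {k}

/-- `I` is generated by a set of paths of `Q`. -/
def LinearIdeal.IsGeneratedByPaths (I : LinearIdeal k (PathCat k Q)) : Prop :=
  ∃ S : ∀ x y : Q, Set (Quiver.Path x y), I = pathIdeal k S

/-- `I` is admissible: `I ⊆ k²Q`, and for every vertex `x` there is `l` such that `I` contains all
paths of length at least `l` with source or target `x`. -/
def LinearIdeal.IsAdmissible (I : LinearIdeal k (PathCat k Q)) : Prop :=
  (∀ x y : PathCat k Q,
      I.carrier x y ≤ ((arrowIdeal k Q).mul (arrowIdeal k Q)).carrier x y) ∧
    ∀ x : Q, ∃ l : ℕ,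
      (∀ (y : Q) (p : Quiver.Path x y), l ≤ p.length →
        pathHom k p ∈ I.carrier (pathVertex k x) (pathVertex k y)) ∧
      (∀ (y : Q) (p : Quiver.Path y x), l ≤ p.length →
        pathHom k p ∈ I.carrier (pathVertex k y) (pathVertex k x))

/-- The vertex `x` of `Q`, as an object of `kQ / I`. -/
def LinearIdeal.vertex (I : LinearIdeal k (PathCat k Q)) (x : Q) : I.Residue :=
  (CategoryTheory.Quotient.functor I.rel).obj (pathVertex k x)

/-- A representation `R` of `kQ / I` in `D` is support-finite if `R(x) ≠ 0` for only finitely many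
vertices `x`. -/
def isSupportFinite (I : LinearIdeal k (PathCat k Q)) (D : Type u') [Category.{v'} D]
    [Preadditive D] [Linear k D] : ObjectProperty (LinFun k I.Residue D) :=
  fun R => {x : Q | ¬ IsZero (R.obj.obj (I.vertex x))}.Finite

/-- `rep(kQ / I, D)`: the full subcategory of `Rep(kQ / I, D) = Fun_k(kQ / I, D)` consisting of the
support-finite representations. -/
abbrev SupportFiniteRep (I : LinearIdeal k (PathCat k Q)) (D : Type u') [Category.{v'} D]
    [Preadditive D] [Linear k D] :=
  (isSupportFinite I D).FullSubcategory

end Quiver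

/-- The functor `Fun_k(B, P) ⥤ Fun_k(B, D)` induced by the inclusion of a full subcategory `P`
of `D`. -/
def LinFun.postcompInclusion (k : Type w) [CommRing k] (B : Type u) [Category.{v} B]
    [Preadditive B] [Linear k B] {D : Type u'} [Category.{v'} D] [Preadditive D] [Linear k D]
    (P : ObjectProperty D) : LinFun k B P.FullSubcategory ⥤ LinFun k B D :=
  (isLinearFunctor k B D).lift
    ((isLinearFunctor k B P.FullSubcategory).ι ⋙ (Functor.whiskeringRight B _ D).obj P.ι)
    (fun R =>
      have := R.property.1
      have := R.property.2
      ⟨inferInstanceAs (R.obj ⋙ P.ι).Additive, inferInstanceAs ((R.obj ⋙ P.ι).Linear k)⟩)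

/-- The inclusion `rep(kQ / I, mod A) ⥤ Rep(kQ / I, Mod A)`. -/
def supportFiniteRepInclusion {k : Type w} [CommRing k] {Q : Type u} [Quiver.{v} Q]
    (I : LinearIdeal k (PathCat k Q)) (A : Type u') [Category.{w} A] [Preadditive A]
    [Linear k A] :
    SupportFiniteRep I (FinPresMod k A) ⥤ LinFun k I.Residue (RightMod k A) :=
  (isSupportFinite I (FinPresMod k A)).ι ⋙ LinFun.postcompInclusion k I.Residue (isFinPres k A)

end

noncomputable section

namespace RightMod

section Presentation

variable {k : Type w} [CommRing k] {C : Type u} [Category.{w} C] [Preadditive C] [Linear k C]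

/-- The right action of the morphisms of `C` on the elements of a right module. -/
def act (M : RightMod k C) (X Y : C) :
    (X ⟶ Y) →ₗ[k] M.obj.obj (op Y) →ₗ[k] M.obj.obj (op X) where
  toFun f := (M.obj.map f.op).hom
  map_add' f g := by
    have := M.property.1
    rw [op_add, Functor.map_add, ModuleCat.hom_add]
  map_smul' r f := by
    have := M.property.2
    have h : (r • f).op = r • f.op := rfl
    rw [h, Functor.map_smul, ModuleCat.hom_smul, RingHom.id_apply]

lemma act_id (M : RightMod k C) (X : C) (m : M.obj.obj (op X)) : act M X X (𝟙 X) m = m := by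
  simp [act]

lemma act_comp (M : RightMod k C) {X Y Z : C} (f : X ⟶ Y) (g : Y ⟶ Z)
    (m : M.obj.obj (op Z)) : act M X Z (f ≫ g) m = act M X Y f (act M Y Z g m) := by
  simp [act]

lemma act_naturality {M N : RightMod k C} (φ : M ⟶ N) {X Y : C} (f : X ⟶ Y)
    (m : M.obj.obj (op Y)) :
    (φ.hom.app (op X)).hom (act M X Y f m) = act N X Y f ((φ.hom.app (op Y)).hom m) :=
  congrArg (fun z => z.hom m) (φ.hom.naturality f.op)

/-- A finite family of elements of a right module generates it. -/
def IsGenerating (M : RightMod k C) {ι : Type*} [Fintype ι] {Y : ι → C}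
    (x : ∀ i, M.obj.obj (op (Y i))) : Prop :=
  ∀ (X : C) (m : M.obj.obj (op X)), ∃ f : ∀ i, X ⟶ Y i, ∑ i, act M X (Y i) (f i) (x i) = m

/-- The relations `r j` hold between the elements `x i` and generate all their relations. -/
def IsRelationBasis (M : RightMod k C) {ι κ : Type*} [Fintype ι] [Fintype κ] {Y : ι → C}
    (x : ∀ i, M.obj.obj (op (Y i))) {Z : κ → C} (r : ∀ j i, Z j ⟶ Y i) : Prop :=
  (∀ j, ∑ i, act M (Z j) (Y i) (r j i) (x i) = 0) ∧
    ∀ (X : C) (f : ∀ i, X ⟶ Y i), ∑ i, act M X (Y i) (f i) (x i) = 0 →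
      ∃ g : ∀ j, X ⟶ Z j, ∀ i, f i = ∑ j, g j ≫ r j i

/-- The relations between the elements `x i` are finitely generated. -/
def HasFiniteRelations (M : RightMod k C) {ι : Type*} [Fintype ι] {Y : ι → C}
    (x : ∀ i, M.obj.obj (op (Y i))) : Prop :=
  ∃ (n : ℕ) (Z : Fin n → C) (r : ∀ j i, Z j ⟶ Y i), IsRelationBasis M x r

lemma IsRelationBasis.hasFiniteRelations {M : RightMod k C} {ι κ : Type*} [Fintype ι] [Fintype κ]
    {Y : ι → C} {x : ∀ i, M.obj.obj (op (Y i))} {Z : κ → C} {r : ∀ j i, Z j ⟶ Y i}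
    (h : IsRelationBasis M x r) : HasFiniteRelations M x := by
  let e := (Fintype.equivFin κ).symm
  refine ⟨Fintype.card κ, fun j => Z (e j), fun j => r (e j), fun j => h.1 _, fun X f hf => ?_⟩
  obtain ⟨g, hg⟩ := h.2 X f hf
  exact ⟨fun j => g (e j), fun i => (hg i).trans (Equiv.sum_comp e fun j => g j ≫ r j i).symm⟩

lemma IsGenerating.comp_equiv {M : RightMod k C} {ι ι' : Type*} [Fintype ι] [Fintype ι']
    {Y : ι → C} {x : ∀ i, M.obj.obj (op (Y i))} (h : IsGenerating M x) (e : ι' ≃ ι) :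
    IsGenerating M (Y := fun i => Y (e i)) fun i => x (e i) := by
  intro X m
  obtain ⟨f, hf⟩ := h X m
  exact ⟨fun i => f (e i), (Equiv.sum_comp e fun i => act M X (Y i) (f i) (x i)).trans hf⟩

/-- The linear map `(f i) ↦ ∑ i, x i · f i` given by elements `x i` of `M`. -/
def combination (M : RightMod k C) {ι : Type*} [Fintype ι] {Y : ι → C}
    (x : ∀ i, M.obj.obj (op (Y i))) (X : C) : (∀ i, X ⟶ Y i) →ₗ[k] M.obj.obj (op X) :=
  ∑ i, (act M X (Y i)).flip (x i) ∘ₗ LinearMap.proj i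

lemma combination_apply (M : RightMod k C) {ι : Type*} [Fintype ι] {Y : ι → C}
    (x : ∀ i, M.obj.obj (op (Y i))) (X : C) (f : ∀ i, X ⟶ Y i) :
    combination M x X f = ∑ i, act M X (Y i) (f i) (x i) := by
  rw [combination, LinearMap.sum_apply]
  rfl

lemma combination_comp (M : RightMod k C) {ι : Type*} [Fintype ι] {Y : ι → C}
    (x : ∀ i, M.obj.obj (op (Y i))) {X' X : C} (g : X' ⟶ X) (f : ∀ i, X ⟶ Y i) :
    combination M x X' (fun i => g ≫ f i) = act M X' X g (combination M x X f) := by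
  simp_rw [combination_apply, act_comp, map_sum]

/-- The morphism `⨁ i, C(-, Y i) ⟶ M` given by elements `x i` of `M`. -/
def ofElements (M : RightMod k C) {n : ℕ} {Y : Fin n → C} (x : ∀ i, M.obj.obj (op (Y i))) :
    repSum k Y ⟶ M :=
  ObjectProperty.homMk
    { app := fun X => ModuleCat.ofHom (combination M x X.unop)
      naturality := fun X X' f => by
        exact ModuleCat.hom_ext (LinearMap.ext fun y => combination_comp M x f.unop y) }

lemma ofElements_apply (M : RightMod k C) {n : ℕ} {Y : Fin n → C}
    (x : ∀ i, M.obj.obj (op (Y i))) (X : C) (f : ∀ i, X ⟶ Y i) :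
    ((ofElements M x).hom.app (op X)).hom f = ∑ i, act M X (Y i) (f i) (x i) :=
  combination_apply M x X f

/-- The `i`-th canonical element of `⨁ i, C(-, Y i)`. -/
def repSumElement (k : Type w) [CommRing k] {C : Type u} [Category.{w} C] [Preadditive C]
    [Linear k C] {n : ℕ} (Y : Fin n → C) (i : Fin n) : (repSum k Y).obj.obj (op (Y i)) :=
  (Pi.single i (𝟙 (Y i)) : ∀ j, Y i ⟶ Y j)

lemma sum_comp_single {ι : Type*} [Fintype ι] [DecidableEq ι] {Y : ι → C} {X : C}
    (f : ∀ i, X ⟶ Y i) (j : ι) :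
    ∑ i, f i ≫ (Pi.single i (𝟙 (Y i)) : ∀ j, Y i ⟶ Y j) j = f j := by
  rw [Finset.sum_eq_single j]
  · simp
  · intro i _ h
    rw [Pi.single_eq_of_ne h.symm, comp_zero]
  · simp

lemma sum_act_repSumElement {n : ℕ} {Y : Fin n → C} {X : C} (f : ∀ i, X ⟶ Y i) :
    ∑ i, act (repSum k Y) X (Y i) (f i) (repSumElement k Y i) = f := by
  refine funext fun j => ?_
  refine Eq.trans ?_ (sum_comp_single f j)
  exact Finset.sum_apply (M := fun j => X ⟶ Y j) j Finset.univ
    fun i => act (repSum k Y) X (Y i) (f i) (repSumElement k Y i)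

lemma hom_repSum_apply {M : RightMod k C} {n : ℕ} {Y : Fin n → C} (p : repSum k Y ⟶ M) {X : C}
    (f : ∀ i, X ⟶ Y i) :
    (p.hom.app (op X)).hom f =
      ∑ i, act M X (Y i) (f i) ((p.hom.app (op (Y i))).hom (repSumElement k Y i)) := by
  conv_lhs => rw [← sum_act_repSumElement (k := k) f]
  rw [map_sum]
  exact Finset.sum_congr rfl fun i _ => act_naturality p _ _

lemma isFinPres_iff (M : RightMod k C) :
    isFinPres k C M ↔ ∃ (n : ℕ) (Y : Fin n → C) (x : ∀ i, M.obj.obj (op (Y i))),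
      IsGenerating M x ∧ HasFiniteRelations M x := by
  constructor
  · rintro ⟨m, n, Z, Y, d, p, h⟩
    refine ⟨n, Y, fun i => (p.hom.app (op (Y i))).hom (repSumElement k Y i), fun X y => ?_, m, Z,
      fun j => (d.hom.app (op (Z j))).hom (repSumElement k Z j), fun j => ?_, fun X f hf => ?_⟩
    · obtain ⟨f, hf⟩ := (h (op X)).2 y
      exact ⟨f, (hom_repSum_apply p f).symm.trans hf⟩
    · refine (hom_repSum_apply p _).symm.trans ?_
      exact (h (op (Z j))).1.apply_apply_eq_zero _
    · rw [← hom_repSum_apply p f] at hf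
      obtain ⟨g, hg⟩ := ((h (op X)).1 f).1 hf
      refine ⟨g, fun i => ?_⟩
      rw [← hg, hom_repSum_apply d g]
      exact Finset.sum_apply (M := fun i => X ⟶ Y i) i Finset.univ
        fun j => act (repSum k Y) X (Z j) (g j)
          ((d.hom.app (op (Z j))).hom (repSumElement k Z j))
  · rintro ⟨n, Y, x, hx, m, Z, r, hr⟩
    refine ⟨m, n, Z, Y, ofElements (repSum k Y) r, ofElements M x,
      fun X => ⟨fun f => ?_, fun y => ?_⟩⟩
    · refine ⟨fun hf => ?_, ?_⟩
      · obtain ⟨g, hg⟩ := hr.2 X.unop f ((ofElements_apply M x X.unop f).symm.trans hf)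
        refine ⟨g, (ofElements_apply _ _ X.unop g).trans (funext fun i => ?_)⟩
        refine Eq.trans ?_ (hg i).symm
        exact Finset.sum_apply (M := fun i => X.unop ⟶ Y i) i Finset.univ
          fun j => act (repSum k Y) X.unop (Z j) (g j) (r j)
      · rintro ⟨g, rfl⟩
        refine (congrArg _ (ofElements_apply _ _ X.unop g)).trans ?_
        rw [map_sum]
        refine Finset.sum_eq_zero fun j _ => (act_naturality (ofElements M x) (g j) _).trans ?_
        rw [ofElements_apply, hr.1 j, map_zero]
    · obtain ⟨f, hf⟩ := hx X.unop y
      exact ⟨f, (ofElements_apply M x X.unop f).trans hf⟩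

lemma isFinPres_of_presentation {M : RightMod k C} {ι κ : Type*} [Fintype ι] [Fintype κ]
    {Y : ι → C} {x : ∀ i, M.obj.obj (op (Y i))} (hx : IsGenerating M x)
    {Z : κ → C} {r : ∀ j i, Z j ⟶ Y i} (hr : IsRelationBasis M x r) : isFinPres k C M := by
  let e := (Fintype.equivFin ι).symm
  refine (isFinPres_iff M).2 ⟨Fintype.card ι, fun i => Y (e i), fun i => x (e i), hx.comp_equiv e,
    IsRelationBasis.hasFiniteRelations (Z := Z) (r := fun j i => r j (e i))
      ⟨fun j => ?_, fun X f hf => ?_⟩⟩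
  · exact (Equiv.sum_comp e fun i => act M (Z j) (Y i) (r j i) (x i)).trans (hr.1 j)
  · obtain ⟨f', rfl⟩ := (Equiv.piCongrLeft (fun i => X ⟶ Y i) e).symm.surjective f
    obtain ⟨g, hg⟩ := hr.2 X f'
      ((Equiv.sum_comp e fun i => act M X (Y i) (f' i) (x i)).symm.trans hf)
    exact ⟨g, fun i => hg (e i)⟩

/-- A variant of Schanuel's lemma: the relations between any finite family of generators of a
finitely presented module are finitely generated. -/
lemma hasFiniteRelations_of_isFinPres {M : RightMod k C} (hM : isFinPres k C M) {ι : Type*}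
    [Fintype ι] {Y : ι → C} {x : ∀ i, M.obj.obj (op (Y i))} (hx : IsGenerating M x) :
    HasFiniteRelations M x := by
  classical
  obtain ⟨n, D, y, hy, m, E, s, hs⟩ := (isFinPres_iff M).1 hM
  choose U hU using fun i => hy (Y i) (x i)
  choose V hV using fun a => hx (D a) (y a)
  have hV' : ∀ (X : C) (h : ∀ a, X ⟶ D a),
      ∑ i, act M X (Y i) (∑ a, h a ≫ V a i) (x i) = ∑ a, act M X (D a) (h a) (y a) := by
    intro X h
    simp_rw [map_sum, LinearMap.sum_apply, act_comp]
    rw [Finset.sum_comm]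
    refine Finset.sum_congr rfl fun a _ => ?_
    rw [← map_sum, hV]
  refine IsRelationBasis.hasFiniteRelations (κ := ι ⊕ Fin m) (Z := Sum.elim Y E)
    (r := fun j => match j with
      | .inl i => fun j => (Pi.single i (𝟙 (Y i)) : ∀ j, Y i ⟶ Y j) j - ∑ a, U i a ≫ V a j
      | .inr b => fun j => ∑ a, s b a ≫ V a j) ⟨?_, fun X f hf => ?_⟩
  · rintro (i | b)
    · change ∑ j, act M (Y i) (Y j) _ _ = 0
      simp_rw [map_sub, LinearMap.sub_apply]
      rw [Finset.sum_sub_distrib, hV' (Y i) (U i), hU, sub_eq_zero, Finset.sum_eq_single i]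
      · simp [act_id]
      · intro j _ h
        simp [Pi.single_eq_of_ne h]
      · simp
    · exact (hV' (E b) (s b)).trans (hs.1 b)
  · have h : ∑ a, act M X (D a) (∑ i, f i ≫ U i a) (y a) = 0 := by
      rw [← hf]
      simp_rw [map_sum, LinearMap.sum_apply, act_comp]
      rw [Finset.sum_comm]
      refine Finset.sum_congr rfl fun i _ => ?_
      rw [← map_sum, hU]
    obtain ⟨g, hg⟩ := hs.2 X _ h
    refine ⟨fun j => match j with
      | .inl i => f i
      | .inr b => g b, fun j => ?_⟩
    rw [Fintype.sum_sum_type]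
    change f j = ∑ i, f i ≫ ((Pi.single i (𝟙 (Y i)) : ∀ j, Y i ⟶ Y j) j - ∑ a, U i a ≫ V a j) +
      ∑ b, g b ≫ ∑ a, s b a ≫ V a j
    simp_rw [Preadditive.comp_sub, Preadditive.comp_sum]
    rw [Finset.sum_sub_distrib, sum_comp_single,
      Finset.sum_comm (f := fun i a => f i ≫ U i a ≫ V a j),
      Finset.sum_comm (f := fun b a => g b ≫ s b a ≫ V a j)]
    simp_rw [← Category.assoc, ← Preadditive.sum_comp, hg]
    simp

end Presentation

end RightMod

/-! ### Finite presentation over a tensor product of `k`-categories -/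

lemma exists_eq_sum_tmul {k P N ι : Type*} [CommRing k] [AddCommGroup P] [Module k P]
    [AddCommGroup N] [Module k N] [Fintype ι] {p : ι → P} (hp : Submodule.span k (Set.range p) = ⊤)
    (t : P ⊗[k] N) : ∃ h : ι → N, t = ∑ i, p i ⊗ₜ[k] h i := by
  induction t using TensorProduct.induction_on with
  | zero => exact ⟨0, by simp⟩
  | tmul a b =>
    obtain ⟨c, rfl⟩ := (Submodule.mem_span_range_iff_exists_fun k).1
      (hp ▸ Submodule.mem_top (x := a))
    exact ⟨fun i => c i • b, by simp [TensorProduct.sum_tmul, TensorProduct.smul_tmul]⟩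
  | add a b ha hb =>
    obtain ⟨f, rfl⟩ := ha
    obtain ⟨g, rfl⟩ := hb
    exact ⟨f + g, by simp [TensorProduct.tmul_add, Finset.sum_add_distrib]⟩

/-- Over a noetherian ring, the relations `∑ i, p i ⊗ h i = 0` for generators `p i` of a module
are governed by a finite set of relations between the `p i`. -/
lemma exists_relations_of_span_eq_top {k P ι : Type*} [CommRing k] [IsNoetherianRing k]
    [AddCommGroup P] [Module k P] [Fintype ι] {p : ι → P}
    (hp : Submodule.span k (Set.range p) = ⊤) :
    ∃ (n : ℕ) (c : Fin n → ι → k), (∀ q, ∑ i, c q i • p i = 0) ∧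
      ∀ (N : Type v) [AddCommGroup N] [Module k N] (h : ι → N), ∑ i, p i ⊗ₜ[k] h i = 0 →
        ∃ g : Fin n → N, ∀ i, h i = ∑ q, c q i • g q := by
  obtain ⟨n, c, hc⟩ := Module.Finite.exists_fin (R := k)
    (M := LinearMap.ker (Fintype.linearCombination k p))
  refine ⟨n, fun q => c q, fun q => (c q).2, fun N _ _ h hh => ?_⟩
  obtain ⟨m, a, y, hy, ha⟩ := TensorProduct.vanishesTrivially_of_sum_tmul_eq_zero k hp hh
  have hd : ∀ j, ∃ d : Fin n → k, ∀ i, a i j = ∑ q, d q * (c q : ι → k) i := by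
    intro j
    obtain ⟨d, hd⟩ := (Submodule.mem_span_range_iff_exists_fun k).1 (hc ▸ Submodule.mem_top
      (x := (⟨fun i => a i j, ha j⟩ : LinearMap.ker (Fintype.linearCombination k p))))
    refine ⟨d, fun i => ?_⟩
    have := congrFun (congrArg Subtype.val hd) i
    simpa using this.symm
  choose d hd using hd
  refine ⟨fun q => ∑ j, d j q • y j, fun i => ?_⟩
  simp_rw [hy, hd, Finset.smul_sum, Finset.sum_smul, smul_smul]
  rw [Finset.sum_comm]
  simp_rw [mul_comm]

namespace TensorCat

variable {k : Type w} [CommRing k] {C : Type u} [Category.{v} C] [Preadditive C] [Linear k C]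
  {D : Type u'} [Category.{v'} D] [Preadditive D] [Linear k D]

lemma homTmul_comp {X Y Z : TensorCat k C D} (f : X.fst ⟶ Y.fst) (g : X.snd ⟶ Y.snd)
    (f' : Y.fst ⟶ Z.fst) (g' : Y.snd ⟶ Z.snd) :
    homTmul f g ≫ homTmul f' g' = (homTmul (f ≫ f') (g ≫ g') : X ⟶ Z) := rfl

/-- The linear map `g ↦ f ⊗ g`. -/
def homTmulRight {X Y : TensorCat k C D} (f : X.fst ⟶ Y.fst) :
    (X.snd ⟶ Y.snd) →ₗ[k] (X ⟶ Y) :=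
  TensorProduct.mk k (X.fst ⟶ Y.fst) (X.snd ⟶ Y.snd) f

lemma homTmul_sum {X Y : TensorCat k C D} (f : X.fst ⟶ Y.fst) {ι : Type*} [Fintype ι]
    (g : ι → (X.snd ⟶ Y.snd)) : (homTmul f (∑ i, g i) : X ⟶ Y) = ∑ i, homTmul f (g i) :=
  map_sum (homTmulRight f) g _

lemma homTmul_sub {X Y : TensorCat k C D} (f : X.fst ⟶ Y.fst) (g g' : X.snd ⟶ Y.snd) :
    (homTmul f (g - g') : X ⟶ Y) = homTmul f g - homTmul f g' :=
  map_sub (homTmulRight f) g g'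

lemma sum_homTmul_sub_eq_zero {X Y : TensorCat k C D} {ι : Type*} [Fintype ι]
    {p : ι → (X.fst ⟶ Y.fst)} {g g' : ι → (X.snd ⟶ Y.snd)}
    (h : (∑ i, homTmul (p i) (g i) : X ⟶ Y) = ∑ i, homTmul (p i) (g' i)) :
    (∑ i, homTmul (p i) (g i - g' i) : X ⟶ Y) = 0 := by
  simp_rw [homTmul_sub]
  rw [Finset.sum_sub_distrib, sub_eq_zero, h]

lemma exists_eq_sum_homTmul {X Y : TensorCat k C D} {ι : Type*} [Fintype ι]
    {p : ι → (X.fst ⟶ Y.fst)} (hp : Submodule.span k (Set.range p) = ⊤) (t : X ⟶ Y) :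
    ∃ h : ι → (X.snd ⟶ Y.snd), t = ∑ i, homTmul (p i) (h i) :=
  exists_eq_sum_tmul hp t

lemma subsingleton_hom {X Y : TensorCat k C D} (h : Subsingleton (X.fst ⟶ Y.fst)) :
    Subsingleton (X ⟶ Y) := by
  refine subsingleton_of_forall_eq 0 fun t => ?_
  induction t using TensorProduct.induction_on with
  | zero => rfl
  | tmul a b =>
    rw [Subsingleton.elim a 0]
    exact TensorProduct.zero_tmul _ _
  | add a b ha hb => exact (congrArg₂ (· + ·) ha hb).trans (add_zero (0 : X ⟶ Y))

end TensorCat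

namespace LinFun

open RightMod

variable {k : Type w} [CommRing k] {B : Type u} [Category.{w} B] [Preadditive B] [Linear k B]
  {A : Type u'} [Category.{w} A] [Preadditive A] [Linear k A]

/-- The action of the morphisms of `B` on the values of a representation in `Mod A`. -/
def move (R : LinFun k B (RightMod k A)) (w v : Bᵒᵖ) (X : A) :
    (w ⟶ v) →ₗ[k] (R.obj.obj v.unop).obj.obj (op X) →ₗ[k] (R.obj.obj w.unop).obj.obj (op X) where
  toFun a := ((R.obj.map a.unop).hom.app (op X)).hom
  map_add' a b := by
    have := R.property.1
    rw [unop_add, Functor.map_add]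
    rfl
  map_smul' r a := by
    have := R.property.2
    have h : (r • a).unop = r • a.unop := rfl
    rw [h, Functor.map_smul]
    rfl

lemma move_id (R : LinFun k B (RightMod k A)) (w : Bᵒᵖ) (X : A)
    (m : (R.obj.obj w.unop).obj.obj (op X)) : move R w w X (𝟙 w) m = m := by
  change ((R.obj.map (𝟙 w.unop)).hom.app (op X)).hom m = m
  rw [CategoryTheory.Functor.map_id]
  rfl

lemma sum_smul_move (R : LinFun k B (RightMod k A)) {w v : Bᵒᵖ} {X : A} {ι : Type*} [Fintype ι]
    (c : ι → k) (a : ι → (w ⟶ v)) (m : (R.obj.obj v.unop).obj.obj (op X)) :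
    ∑ i, c i • move R w v X (a i) m = move R w v X (∑ i, c i • a i) m := by
  simp only [map_sum, map_smul, LinearMap.sum_apply, LinearMap.smul_apply]

lemma act_homTmul (R : LinFun k B (RightMod k A)) {S T : TensorCat k Bᵒᵖ A} (a : S.fst ⟶ T.fst)
    (f : S.snd ⟶ T.snd) (m : (compareObj R).obj.obj (op T)) :
    act (compareObj R) S T (TensorCat.homTmul a f) m =
      act (R.obj.obj S.fst.unop) S.snd T.snd f (move R S.fst T.fst T.snd a m) :=
  act_naturality (R.obj.map a.unop) f m

lemma act_sum_homTmul (R : LinFun k B (RightMod k A)) {S T : TensorCat k Bᵒᵖ A} {ι : Type*}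
    [Fintype ι] (a : ι → (S.fst ⟶ T.fst)) (f : ι → (S.snd ⟶ T.snd))
    (m : (compareObj R).obj.obj (op T)) :
    act (compareObj R) S T (∑ i, TensorCat.homTmul (a i) (f i)) m =
      ∑ i, act (R.obj.obj S.fst.unop) S.snd T.snd (f i) (move R S.fst T.fst T.snd (a i) m) := by
  rw [map_sum, LinearMap.sum_apply]
  exact Finset.sum_congr rfl fun i _ => act_homTmul R (a i) (f i) m

/-- The elements `x i · p` of `R(w)`, for elements `x i` of `Φ(R)` and morphisms `p` in chosen
finite families. -/
def movedElements (R : LinFun k B (RightMod k A)) {ι : Type*} {Y : ι → TensorCat k Bᵒᵖ A}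
    (x : ∀ i, (compareObj R).obj.obj (op (Y i))) (w : Bᵒᵖ) {n : ι → ℕ}
    (p : ∀ i, Fin (n i) → (w ⟶ (Y i).fst)) (s : Σ i, Fin (n i)) :
    (R.obj.obj w.unop).obj.obj (op (Y s.1).snd) :=
  move R w (Y s.1).fst (Y s.1).snd (p s.1 s.2) (x s.1)

lemma sum_act_movedElements (R : LinFun k B (RightMod k A)) {ι : Type*} [Fintype ι]
    {Y : ι → TensorCat k Bᵒᵖ A} (x : ∀ i, (compareObj R).obj.obj (op (Y i))) (w : Bᵒᵖ) {n : ι → ℕ}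
    (p : ∀ i, Fin (n i) → (w ⟶ (Y i).fst)) (X : A) (h : ∀ s : Σ i, Fin (n i), X ⟶ (Y s.1).snd) :
    ∑ s, act (R.obj.obj w.unop) X (Y s.1).snd (h s) (movedElements R x w p s) =
      ∑ i, act (compareObj R) ⟨w, X⟩ (Y i) (∑ a, TensorCat.homTmul (p i a) (h ⟨i, a⟩)) (x i) := by
  rw [Fintype.sum_sigma]
  exact Finset.sum_congr rfl fun i _ => (act_sum_homTmul R (S := ⟨w, X⟩) (T := Y i) (p i)
    (fun a => h ⟨i, a⟩) (x i)).symm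

lemma isGenerating_movedElements {R : LinFun k B (RightMod k A)} {ι : Type*} [Fintype ι]
    {Y : ι → TensorCat k Bᵒᵖ A} {x : ∀ i, (compareObj R).obj.obj (op (Y i))}
    (hx : IsGenerating (compareObj R) x) (w : Bᵒᵖ) {n : ι → ℕ}
    {p : ∀ i, Fin (n i) → (w ⟶ (Y i).fst)} (hp : ∀ i, Submodule.span k (Set.range (p i)) = ⊤) :
    IsGenerating (R.obj.obj w.unop) (movedElements R x w p) := by
  intro X m
  obtain ⟨f, hf⟩ := hx ⟨w, X⟩ m
  choose h hh using fun i => TensorCat.exists_eq_sum_homTmul (hp i) (f i)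
  refine ⟨fun s => h s.1 s.2, (sum_act_movedElements R x w p X _).trans (Eq.trans ?_ hf)⟩
  exact Finset.sum_congr rfl fun i _ => by rw [hh i]

/-- The values of a representation `R` are finitely presented if `Φ(R)` is. -/
lemma isFinPres_obj [IsNoetherianRing k] (hB : ∀ x y : Bᵒᵖ, Module.Finite k (x ⟶ y))
    {R : LinFun k B (RightMod k A)} (hR : isFinPres k _ (compareObj R)) (v : B) :
    isFinPres k A (R.obj.obj v) := by
  classical
  obtain ⟨n, Y, x, hx, m, Z, r, hr⟩ := (isFinPres_iff _).1 hR
  set w : Bᵒᵖ := op v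
  choose n' p hp using fun i => (hB w (Y i).fst).exists_fin
  choose m' q hq using fun j => (hB w (Z j).fst).exists_fin
  choose l c hc hc' using fun i => exists_relations_of_span_eq_top.{w} (hp i)
  choose ρ hρ using fun j b i => TensorCat.exists_eq_sum_homTmul (k := k) (D := A)
    (X := ⟨w, (Z j).snd⟩) (Y := Y i) (hp i) (TensorCat.homTmul (q j b) (𝟙 (Z j).snd) ≫ r j i)
  refine isFinPres_of_presentation (isGenerating_movedElements hx w hp)
    (κ := (Σ i, Fin (l i)) ⊕ Σ j, Fin (m' j))
    (Z := Sum.elim (fun s => (Y s.1).snd) fun s => (Z s.1).snd)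
    (r := fun t => match t with
      | .inl t => fun s =>
        (Pi.single t.1 (fun a => c t.1 t.2 a • 𝟙 (Y t.1).snd) :
          ∀ i, Fin (n' i) → ((Y t.1).snd ⟶ (Y i).snd)) s.1 s.2
      | .inr t => fun s => ρ t.1 t.2 s.1 s.2) ⟨?_, fun X f hf => ?_⟩
  · rintro (⟨i, b⟩ | ⟨j, b⟩)
    · change ∑ s : Σ i, Fin (n' i), act (R.obj.obj v) (Y i).snd (Y s.1).snd _ _ = 0
      rw [Fintype.sum_sigma, Fintype.sum_eq_single i]
      · refine Eq.trans (Finset.sum_congr rfl fun a _ => ?_)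
          ((sum_smul_move R (c i b) (p i) (x i)).trans ?_)
        rotate_left
        · rw [hc i b, map_zero]
          rfl
        dsimp only
        rw [Pi.single_eq_same, map_smul, LinearMap.smul_apply, act_id]
        rfl
      · intro i' h
        refine Finset.sum_eq_zero fun a _ => ?_
        dsimp only
        rw [Pi.single_eq_of_ne h, Pi.zero_apply, map_zero, LinearMap.zero_apply]
    · refine (sum_act_movedElements R x w p _ _).trans ?_
      have h : ∀ i, act (compareObj R) ⟨w, (Z j).snd⟩ (Y i)
          (∑ a, TensorCat.homTmul (p i a) (ρ j b i a)) (x i) =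
          act (compareObj R) ⟨w, (Z j).snd⟩ (Z j) (TensorCat.homTmul (q j b) (𝟙 (Z j).snd))
            (act (compareObj R) (Z j) (Y i) (r j i) (x i)) := fun i => by
        rw [← hρ, act_comp]
      refine (Finset.sum_congr rfl fun i _ => h i).trans ?_
      rw [← map_sum, hr.1, map_zero]
      rfl
  · obtain ⟨g, hg⟩ := hr.2 ⟨w, X⟩ (fun i => ∑ a, TensorCat.homTmul (p i a) (f ⟨i, a⟩))
      ((sum_act_movedElements R x w p X f).symm.trans hf)
    choose h hh using fun j => TensorCat.exists_eq_sum_homTmul (hq j) (g j)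
    have key : ∀ i, (∑ a, TensorCat.homTmul (p i a) (f ⟨i, a⟩) : (⟨w, X⟩ : TensorCat k Bᵒᵖ A) ⟶ Y i)
        = ∑ a, TensorCat.homTmul (p i a) (∑ j, ∑ b, h j b ≫ ρ j b i a) := by
      intro i
      have hswap : ∀ j b, (TensorCat.homTmul (q j b) (h j b) :
          (⟨w, X⟩ : TensorCat k Bᵒᵖ A) ⟶ Z j) ≫ r j i =
          ∑ a, TensorCat.homTmul (p i a) (h j b ≫ ρ j b i a) := by
        intro j b
        have h₁ : (TensorCat.homTmul (q j b) (h j b) : (⟨w, X⟩ : TensorCat k Bᵒᵖ A) ⟶ Z j) =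
            (TensorCat.homTmul (𝟙 w) (h j b) :
              (⟨w, X⟩ : TensorCat k Bᵒᵖ A) ⟶ ⟨w, (Z j).snd⟩) ≫
              TensorCat.homTmul (q j b) (𝟙 (Z j).snd) := by
          rw [TensorCat.homTmul_comp, Category.id_comp, Category.comp_id]
        rw [h₁, Category.assoc, hρ, Preadditive.comp_sum]
        refine Finset.sum_congr rfl fun a _ => ?_
        rw [TensorCat.homTmul_comp, Category.id_comp]
      rw [hg i]
      refine (Finset.sum_congr rfl fun j _ => ((congrArg (· ≫ r j i) (hh j)).trans
        (Preadditive.sum_comp _ _ _)).trans (Finset.sum_congr rfl fun b _ => hswap j b)).trans ?_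
      refine Eq.trans ?_ (Finset.sum_congr rfl fun a _ => ((TensorCat.homTmul_sum _ _).trans
        (Finset.sum_congr rfl fun j _ => TensorCat.homTmul_sum _ _)).symm)
      exact (Finset.sum_congr rfl fun j _ => Finset.sum_comm).trans Finset.sum_comm
    have key' : ∀ i, (∑ a, TensorCat.homTmul (p i a) (f ⟨i, a⟩ - ∑ j, ∑ b, h j b ≫ ρ j b i a) :
        (⟨w, X⟩ : TensorCat k Bᵒᵖ A) ⟶ Y i) = 0 := by
      intro i
      exact TensorCat.sum_homTmul_sub_eq_zero (key i)
    choose e he using fun i => hc' i _ _ (key' i)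
    refine ⟨fun t => match t with
      | .inl t => e t.1 t.2
      | .inr t => h t.1 t.2, ?_⟩
    rintro ⟨i, a⟩
    rw [Fintype.sum_sum_type, Fintype.sum_sigma, Fintype.sum_sigma, Fintype.sum_eq_single i]
    · refine (sub_eq_iff_eq_add.1 (he i a)).trans (congrArg₂ (· + ·) ?_ rfl)
      refine Finset.sum_congr rfl fun b _ => ?_
      dsimp only
      rw [Pi.single_eq_same]
      exact ((Linear.comp_smul _ _ _ (e i b) _ (𝟙 _)).trans
        (congrArg _ (Category.comp_id _))).symm
    · intro i' h
      refine Finset.sum_eq_zero fun b _ => ?_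
      dsimp only
      rw [Pi.single_eq_of_ne h.symm, Pi.zero_apply]
      exact comp_zero

/-- `Φ(R)` is finitely presented if the values of `R` are finitely presented and vanish outside a
finite set of objects. -/
lemma isFinPres_compareObj (hB : ∀ x y : Bᵒᵖ, Module.Finite k (x ⟶ y))
    (hB' : ∀ y : Bᵒᵖ, {x : Bᵒᵖ | Nontrivial (x ⟶ y)}.Finite)
    {R : LinFun k B (RightMod k A)} (hR : ∀ v, isFinPres k A (R.obj.obj v))
    {V : Set Bᵒᵖ} (hV : V.Finite)
    (hRV : ∀ v ∉ V, ∀ X, Subsingleton ((R.obj.obj v.unop).obj.obj X)) :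
    isFinPres k _ (compareObj R) := by
  classical
  choose n D z hz hz' using fun v => (isFinPres_iff _).1 (hR v)
  have : Fintype V := hV.fintype
  let Y : (Σ v : V, Fin (n v.1.unop)) → TensorCat k Bᵒᵖ A := fun s => ⟨s.1.1, D s.1.1.unop s.2⟩
  let x : ∀ s, (compareObj R).obj.obj (op (Y s)) := fun s => z s.1.1.unop s.2
  have hx : IsGenerating (compareObj R) x := by
    rintro ⟨w, X⟩ m
    by_cases hw : w ∈ V
    · obtain ⟨f, hf⟩ := hz w.unop X m
      refine ⟨fun s => (Pi.single ⟨w, hw⟩ (fun i => TensorCat.homTmul (𝟙 w) (f i)) :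
        ∀ v : V, ∀ i : Fin (n v.1.unop),
          (⟨w, X⟩ : TensorCat k Bᵒᵖ A) ⟶ Y ⟨v, i⟩) s.1 s.2, ?_⟩
      rw [Fintype.sum_sigma, Fintype.sum_eq_single ⟨w, hw⟩]
      · refine (Finset.sum_congr rfl fun i _ => ?_).trans hf
        dsimp only
        rw [Pi.single_eq_same]
        exact (act_homTmul R (S := ⟨w, X⟩) (T := Y ⟨⟨w, hw⟩, i⟩) (𝟙 w) (f i) _).trans
          (congrArg _ (move_id R w _ _))
      · intro v hv
        refine Finset.sum_eq_zero fun i _ => ?_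
        dsimp only
        rw [Pi.single_eq_of_ne hv, Pi.zero_apply, map_zero, LinearMap.zero_apply]
    · exact ⟨fun _ => 0, (hRV w hw (op X)).elim _ _⟩
  have hW := hV.biUnion fun v _ => hB' v
  set W : Set Bᵒᵖ := ⋃ v ∈ V, {x : Bᵒᵖ | Nontrivial (x ⟶ v)}
  have : Fintype W := hW.fintype
  choose N p hp using fun w s => (hB w (Y s).fst).exists_fin
  choose m Z r hr using fun w : Bᵒᵖ => hasFiniteRelations_of_isFinPres (hR w.unop)
    (isGenerating_movedElements hx w (hp w))
  refine isFinPres_of_presentation hx (κ := Σ w : W, Fin (m w.1))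
    (Z := fun t => ⟨t.1.1, Z t.1.1 t.2⟩)
    (r := fun t s => ∑ a, TensorCat.homTmul (p t.1.1 s a) (r t.1.1 t.2 ⟨s, a⟩)) ⟨?_, ?_⟩
  · rintro ⟨w, j⟩
    exact (sum_act_movedElements R x w.1 (p w.1) _ _).symm.trans ((hr w.1).1 j)
  · rintro ⟨w, X⟩ f hf
    by_cases hw : w ∈ W
    · choose h hh using fun s => TensorCat.exists_eq_sum_homTmul (hp w s) (f s)
      obtain ⟨g, hg⟩ := (hr w).2 X (fun s => h s.1 s.2) (by
        refine (sum_act_movedElements R x w (p w) X _).trans (Eq.trans ?_ hf)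
        exact Finset.sum_congr rfl fun s _ => by rw [hh s])
      refine ⟨fun t => (Pi.single ⟨w, hw⟩ (fun j => TensorCat.homTmul (𝟙 w) (g j)) :
        ∀ w' : W, ∀ j : Fin (m w'.1),
          (⟨w, X⟩ : TensorCat k Bᵒᵖ A) ⟶ ⟨w'.1, Z w'.1 j⟩) t.1 t.2, fun s => ?_⟩
      rw [Fintype.sum_sigma, Fintype.sum_eq_single ⟨w, hw⟩]
      · refine (hh s).trans ?_
        refine Eq.trans ?_ (Finset.sum_congr rfl fun j _ => ?_ :
          ∑ j, ∑ a, TensorCat.homTmul (p w s a) (g j ≫ r w j ⟨s, a⟩) = _)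
        · rw [Finset.sum_comm]
          refine Finset.sum_congr rfl fun a _ => ?_
          exact (congrArg _ (hg ⟨s, a⟩)).trans (TensorCat.homTmul_sum _ _)
        · dsimp only
          rw [Pi.single_eq_same, Preadditive.comp_sum]
          refine Finset.sum_congr rfl fun a _ => ?_
          rw [TensorCat.homTmul_comp, Category.id_comp]
      · intro w' hw'
        refine Finset.sum_eq_zero fun i _ => ?_
        dsimp only
        rw [Pi.single_eq_of_ne hw', Pi.zero_apply, zero_comp]
    · refine ⟨fun _ => 0, fun s => (TensorCat.subsingleton_hom ?_).elim _ _⟩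
      refine not_nontrivial_iff_subsingleton.1 fun h => hw ?_
      exact Set.mem_biUnion s.1.2 h

end LinFun

/-! ### The comparison functor is an equivalence -/

section CompareEquivalence

open RightMod

variable {k : Type w} [CommRing k] {B : Type u} [Category.{w} B] [Preadditive B] [Linear k B]
  {A : Type u'} [Category.{w} A] [Preadditive A] [Linear k A]

namespace TensorCat

variable (k) {C : Type u} [Category.{v} C] [Preadditive C] [Linear k C]
  {D : Type u'} [Category.{v'} D] [Preadditive D] [Linear k D]

/-- The functor `d ↦ (c, d)`. -/
def inclRight (c : C) : D ⥤ TensorCat k C D where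
  obj d := ⟨c, d⟩
  map f := homTmul (𝟙 c) f
  map_comp f g := by rw [homTmul_comp, Category.id_comp]

/-- The morphism `(c, d) ⟶ (c', d)` given by a morphism of `C`, linearly in the morphism. -/
def homLeft (c c' : C) (d : D) : (c ⟶ c') →ₗ[k] ((⟨c, d⟩ : TensorCat k C D) ⟶ ⟨c', d⟩) :=
  (TensorProduct.mk k (c ⟶ c') (d ⟶ d)).flip (𝟙 d)

instance (c : C) : (inclRight k c : D ⥤ TensorCat k C D).Additive where
  map_add := TensorProduct.tmul_add _ _ _

instance (c : C) : (inclRight k c : D ⥤ TensorCat k C D).Linear k where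
  map_smul {X Y} f r :=
    (homTmulRight (X := ⟨c, X⟩) (Y := ⟨c, Y⟩) (𝟙 c) : _ →ₗ[k] _).map_smul r f

end TensorCat

lemma compareMap_homTmul_id (R : LinFun k B (RightMod k A)) (v : Bᵒᵖ) {a b : A} (f : b ⟶ a) :
    compareMap R ⟨v, b⟩ ⟨v, a⟩ (TensorCat.homTmul (𝟙 v) f) = (R.obj.obj v.unop).obj.map f.op := by
  rw [compareMap_tmul]
  change _ ≫ (R.obj.map (𝟙 v.unop)).hom.app (op b) = _
  rw [CategoryTheory.Functor.map_id]
  exact Category.comp_id _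

lemma compareMap_homTmul_id_right (R : LinFun k B (RightMod k A)) {v w : Bᵒᵖ} (p : w ⟶ v)
    (a : A) :
    compareMap R ⟨w, a⟩ ⟨v, a⟩ (TensorCat.homTmul p (𝟙 a)) =
      (R.obj.map p.unop).hom.app (op a) := by
  rw [compareMap_tmul]
  change (R.obj.obj v.unop).obj.map (𝟙 (op a)) ≫ _ = _
  rw [CategoryTheory.Functor.map_id]
  exact Category.id_comp _

instance compareFunctor_faithful : (compareFunctor k B A).Faithful where
  map_injective {R R'} φ ψ h := by
    refine ObjectProperty.hom_ext _ (NatTrans.ext (funext fun v => ObjectProperty.hom_ext _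
      (NatTrans.ext (funext fun X => ?_))))
    exact congrArg (fun z => z.hom.app (op (⟨op v, X.unop⟩ : TensorCat k Bᵒᵖ A))) h

instance compareFunctor_full : (compareFunctor k B A).Full where
  map_surjective {R R'} ψ := by
    have h (S T : TensorCat k Bᵒᵖ A) (t : S ⟶ T) :
        compareMap R S T t ≫ ψ.hom.app (op S) = ψ.hom.app (op T) ≫ compareMap R' S T t :=
      ψ.hom.naturality t.op
    refine ⟨ObjectProperty.homMk
      { app := fun v => ObjectProperty.homMk
          { app := fun X => ψ.hom.app (op ⟨op v, X.unop⟩)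
            naturality := fun X Y f => ?_ }
        naturality := fun v w p => ObjectProperty.hom_ext _ (NatTrans.ext (funext fun X => ?_)) },
      rfl⟩
    · have h' := h ⟨op v, Y.unop⟩ ⟨op v, X.unop⟩ (TensorCat.homTmul (𝟙 _) f.unop)
      rwa [compareMap_homTmul_id, compareMap_homTmul_id] at h'
    · have h' := h ⟨op w, X.unop⟩ ⟨op v, X.unop⟩ (TensorCat.homTmul p.op (𝟙 _))
      rwa [compareMap_homTmul_id_right, compareMap_homTmul_id_right] at h'

/-- The right `A`-module `N(v, -)`, for a right module `N` over `Bᵒᵖ ⊗_k A`. -/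
def RightMod.sliceObj (N : RightMod k (TensorCat k Bᵒᵖ A)) (v : B) : RightMod k A where
  obj := (TensorCat.inclRight k (op v)).op ⋙ N.obj
  property := by
    have := N.property.1
    have := N.property.2
    refine ⟨⟨fun {X Y f g} => ?_⟩, ⟨fun {X Y} f r => ?_⟩⟩
    · exact (congrArg N.obj.map (congrArg Quiver.Hom.op
        ((TensorCat.inclRight k (op v)).map_add (f := f.unop) (g := g.unop)))).trans
        N.obj.map_add
    · exact (congrArg N.obj.map (congrArg Quiver.Hom.op
        ((TensorCat.inclRight k (op v)).map_smul r f.unop))).trans (N.obj.map_smul r _)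

/-- The representation `v ↦ N(v, -)` in `Mod A`, for a right module `N` over `Bᵒᵖ ⊗_k A`. -/
def RightMod.slice (N : RightMod k (TensorCat k Bᵒᵖ A)) : LinFun k B (RightMod k A) where
  obj :=
    { obj := N.sliceObj
      map := fun {v w} p => ObjectProperty.homMk
        { app := fun X => N.obj.map (TensorCat.homLeft k (op w) (op v) X.unop p.op).op
          naturality := fun X Y f => by
            change N.obj.map (TensorCat.homTmul (𝟙 (op v)) f.unop :
                (⟨op v, Y.unop⟩ : TensorCat k Bᵒᵖ A) ⟶ ⟨op v, X.unop⟩).op ≫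
              N.obj.map (TensorCat.homTmul p.op (𝟙 _) :
                (⟨op w, Y.unop⟩ : TensorCat k Bᵒᵖ A) ⟶ ⟨op v, Y.unop⟩).op =
              N.obj.map (TensorCat.homTmul p.op (𝟙 _) :
                (⟨op w, X.unop⟩ : TensorCat k Bᵒᵖ A) ⟶ ⟨op v, X.unop⟩).op ≫
              N.obj.map (TensorCat.homTmul (𝟙 (op w)) f.unop :
                (⟨op w, Y.unop⟩ : TensorCat k Bᵒᵖ A) ⟶ ⟨op w, X.unop⟩).op
            rw [← Functor.map_comp, ← Functor.map_comp, ← op_comp, ← op_comp,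
              TensorCat.homTmul_comp, TensorCat.homTmul_comp]
            simp only [Category.id_comp, Category.comp_id] }
      map_id := fun v => ObjectProperty.hom_ext _ (NatTrans.ext (funext fun X =>
        N.obj.map_id (op ⟨op v, X.unop⟩)))
      map_comp := fun {u v w} p q => ObjectProperty.hom_ext _ (NatTrans.ext (funext fun X => by
        change N.obj.map (TensorCat.homTmul (q.op ≫ p.op) (𝟙 _) :
            (⟨op w, X.unop⟩ : TensorCat k Bᵒᵖ A) ⟶ ⟨op u, X.unop⟩).op =
          N.obj.map (TensorCat.homTmul p.op (𝟙 _) :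
            (⟨op v, X.unop⟩ : TensorCat k Bᵒᵖ A) ⟶ ⟨op u, X.unop⟩).op ≫
          N.obj.map (TensorCat.homTmul q.op (𝟙 _) :
            (⟨op w, X.unop⟩ : TensorCat k Bᵒᵖ A) ⟶ ⟨op v, X.unop⟩).op
        rw [← Functor.map_comp]
        refine congrArg (fun z => N.obj.map (Quiver.Hom.op z)) (?_ :
          (TensorCat.homTmul (q.op ≫ p.op) (𝟙 X.unop) :
            (⟨op w, X.unop⟩ : TensorCat k Bᵒᵖ A) ⟶ ⟨op u, X.unop⟩) =
          (TensorCat.homTmul q.op (𝟙 X.unop) :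
            (⟨op w, X.unop⟩ : TensorCat k Bᵒᵖ A) ⟶ ⟨op v, X.unop⟩) ≫
              TensorCat.homTmul p.op (𝟙 X.unop))
        rw [TensorCat.homTmul_comp, Category.id_comp])) }
  property := by
    have := N.property.1
    have := N.property.2
    refine ⟨⟨fun {v w p q} => ?_⟩, ⟨fun {v w} p r => ?_⟩⟩ <;>
      refine ObjectProperty.hom_ext _ (NatTrans.ext (funext fun X => ?_))
    · exact (congrArg N.obj.map (congrArg Quiver.Hom.op
        (map_add (TensorCat.homLeft k (op w) (op v) X.unop) p.op q.op))).trans N.obj.map_add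
    · exact (congrArg N.obj.map (congrArg Quiver.Hom.op
        (map_smul (TensorCat.homLeft k (op w) (op v) X.unop) r p.op))).trans (N.obj.map_smul r _)

lemma compareMap_slice (N : RightMod k (TensorCat k Bᵒᵖ A)) {S T : TensorCat k Bᵒᵖ A}
    (t : S ⟶ T) : compareMap N.slice S T t = N.obj.map t.op := by
  have := N.property.1
  induction t using TensorProduct.induction_on with
  | zero => exact (map_zero (compareMap N.slice S T)).trans (N.obj.map_zero _ _).symm
  | add a b ha hb =>
    exact (map_add (compareMap N.slice S T) a b).trans
      ((congrArg₂ (· + ·) ha hb).trans (N.obj.map_add (f := Quiver.Hom.op (X := S) (Y := T) a)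
        (g := Quiver.Hom.op (X := S) (Y := T) b)).symm)
  | tmul p f =>
    refine (compareMap_tmul N.slice p f).trans ?_
    change N.obj.map (TensorCat.homTmul (𝟙 T.fst) f :
        (⟨T.fst, S.snd⟩ : TensorCat k Bᵒᵖ A) ⟶ ⟨T.fst, T.snd⟩).op ≫
      N.obj.map (TensorCat.homTmul p (𝟙 _) :
        (⟨S.fst, S.snd⟩ : TensorCat k Bᵒᵖ A) ⟶ ⟨T.fst, S.snd⟩).op = _
    rw [← Functor.map_comp, ← op_comp, TensorCat.homTmul_comp, Category.id_comp, Category.comp_id]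
    rfl

/-- `Φ(N(-, -)) ≅ N`. -/
def compareSliceIso (N : RightMod k (TensorCat k Bᵒᵖ A)) :
    (compareFunctor k B A).obj N.slice ≅ N :=
  (isLinearFunctor k _ _).isoMk (NatIso.ofComponents (fun _ => Iso.refl _) fun {S T} t => by
    refine (Category.comp_id _).trans (Eq.trans ?_ (Category.id_comp _).symm)
    exact compareMap_slice N t.unop)

instance compareFunctor_essSurj : (compareFunctor k B A).EssSurj where
  mem_essImage N := ⟨N.slice, ⟨compareSliceIso N⟩⟩

instance compareFunctor_isEquivalence : (compareFunctor k B A).IsEquivalence where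

end CompareEquivalence

/-! ### Finiteness of the residue categories of path categories -/

section PathCategory

variable {k : Type w} [CommRing k] {Q : Type u} [Quiver.{v} Q]

lemma finite_setOf_path_length_lt (hQ : IsLocallyFiniteQuiver Q) (x : Q) (n : ℕ) :
    {s : Σ y : Q, Quiver.Path x y | s.2.length < n}.Finite := by
  induction n with
  | zero => simp
  | succ n ih =>
    have (s : Σ y : Q, Quiver.Path x y) : Finite (Σ y : Q, (s.1 ⟶ y)) := (hQ s.1).1
    refine ((Set.finite_singleton (⟨x, .nil⟩ : Σ y : Q, Quiver.Path x y)).union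
      (ih.biUnion fun s _ => Set.finite_range
        fun a : Σ y : Q, (s.1 ⟶ y) => (⟨a.1, s.2.cons a.2⟩ : Σ y : Q, Quiver.Path x y))).subset ?_
    rintro ⟨y, p⟩ hp
    cases p with
    | nil => exact Or.inl rfl
    | cons p a =>
      have hp' : p.length < n := Nat.lt_of_succ_lt_succ (show p.length + 1 < n + 1 from hp)
      exact Or.inr (Set.mem_biUnion (x := ⟨_, p⟩) hp' ⟨⟨_, a⟩, rfl⟩)

lemma span_range_pathHom (x y : Q) :
    Submodule.span k (Set.range fun p : Quiver.Path x y => pathHom k p) = ⊤ := by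
  refine eq_top_iff.2 fun f _ => ?_
  change (Quiver.Path x y →₀ k) at f
  induction f using Finsupp.induction_linear with
  | zero => exact Submodule.zero_mem _
  | add f g hf hg => exact Submodule.add_mem _ (hf trivial) (hg trivial)
  | single p r =>
    have h : (Finsupp.single p r : Quiver.Path x y →₀ k) = r • Finsupp.single p 1 := by simp
    rw [h]
    exact Submodule.smul_mem _ r (Submodule.subset_span ⟨p, rfl⟩)

namespace LinearIdeal

/-- The projection onto the residue category, as a linear map on Hom modules. -/
def residueMap {C : Type u} [Category.{v} C] [Preadditive C] [Linear k C] (I : LinearIdeal k C)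
    (X Y : C) : (X ⟶ Y) →ₗ[k] ((CategoryTheory.Quotient.functor I.rel).obj X ⟶
      (CategoryTheory.Quotient.functor I.rel).obj Y) where
  toFun f := (CategoryTheory.Quotient.functor I.rel).map f
  map_add' _ _ := (CategoryTheory.Quotient.functor I.rel).map_add
  map_smul' _ _ := rfl

lemma residueMap_eq_zero {C : Type u} [Category.{v} C] [Preadditive C] [Linear k C]
    (I : LinearIdeal k C) {X Y : C} {f : X ⟶ Y} (hf : f ∈ I.carrier X Y) :
    I.residueMap X Y f = 0 := by
  refine (CategoryTheory.Quotient.sound I.rel (?_ : I.rel f 0)).trans (map_zero (I.residueMap X Y))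
  rwa [rel, sub_zero]

lemma span_residue_short_paths (I : LinearIdeal k (PathCat k Q)) {x : Q} {l : ℕ}
    (hl : ∀ (y : Q) (p : Quiver.Path x y), l ≤ p.length →
      pathHom k p ∈ I.carrier (pathVertex k x) (pathVertex k y)) (y : Q) :
    Submodule.span k ((fun p : Quiver.Path x y => I.residueMap _ _ (pathHom k p)) ''
      {p | p.length < l}) = ⊤ := by
  refine eq_top_iff.2 fun f _ => ?_
  obtain ⟨f, rfl⟩ := (CategoryTheory.Quotient.functor I.rel).map_surjective f
  have hf : f ∈ Submodule.span k (Set.range fun p : Quiver.Path x y => pathHom k p) :=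
    span_range_pathHom (k := k) x y ▸ Submodule.mem_top
  change I.residueMap _ _ f ∈ _
  induction hf using Submodule.span_induction with
  | mem f hf =>
    obtain ⟨p, rfl⟩ := hf
    by_cases hp : p.length < l
    · exact Submodule.subset_span ⟨p, hp, rfl⟩
    · rw [I.residueMap_eq_zero (hl y p (not_lt.1 hp))]
      exact Submodule.zero_mem _
  | zero => rw [map_zero]; exact Submodule.zero_mem _
  | add f g _ _ hf hg => rw [map_add]; exact Submodule.add_mem _ (hf trivial) (hg trivial)
  | smul r f _ hf => rw [map_smul]; exact Submodule.smul_mem _ r (hf trivial)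

lemma finite_residue_hom (hQ : IsLocallyFiniteQuiver Q) {I : LinearIdeal k (PathCat k Q)}
    (hI : I.IsAdmissible) (x y : I.Residue) : Module.Finite k (x ⟶ y) := by
  suffices h : ∀ x y : Q, Module.Finite k (I.vertex x ⟶ I.vertex y) from h x.as y.as
  intro x y
  obtain ⟨l, hl, -⟩ := hI.2 x
  refine ⟨Submodule.fg_def.2 ⟨_, ?_, I.span_residue_short_paths hl y⟩⟩
  refine Set.Finite.image _ ?_
  exact (finite_setOf_path_length_lt hQ x l).preimage
    (f := fun p : Quiver.Path x y => (⟨_, p⟩ : Σ y : Q, Quiver.Path x y))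
    (sigma_mk_injective.injOn)

lemma finite_residue_op_hom (hQ : IsLocallyFiniteQuiver Q) {I : LinearIdeal k (PathCat k Q)}
    (hI : I.IsAdmissible) (x y : I.Residueᵒᵖ) : Module.Finite k (x ⟶ y) := by
  have := finite_residue_hom hQ hI y.unop x.unop
  exact Module.Finite.equiv
    ({ toFun := Quiver.Hom.op, invFun := Quiver.Hom.unop, map_add' := fun _ _ => rfl,
       map_smul' := fun _ _ => rfl } : (y.unop ⟶ x.unop) ≃ₗ[k] (x ⟶ y))

lemma finite_setOf_nontrivial_residue_hom (hQ : IsLocallyFiniteQuiver Q)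
    {I : LinearIdeal k (PathCat k Q)} (hI : I.IsAdmissible) (x : I.Residue) :
    {y : I.Residue | Nontrivial (x ⟶ y)}.Finite := by
  suffices h : ∀ x : Q, {y : Q | Nontrivial (I.vertex x ⟶ I.vertex y)}.Finite from
    ((h x.as).image I.vertex).subset fun y hy => ⟨y.as, hy, rfl⟩
  intro x
  obtain ⟨l, hl, -⟩ := hI.2 x
  refine ((finite_setOf_path_length_lt hQ x l).image fun s => s.1).subset fun y hy => ?_
  have h : ((fun p : Quiver.Path x y => I.residueMap _ _ (pathHom k p)) ''
      {p | p.length < l}).Nonempty := by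
    rw [Set.nonempty_iff_ne_empty]
    intro h
    have h' := I.span_residue_short_paths hl y
    rw [h, Submodule.span_empty] at h'
    have : Nontrivial ((CategoryTheory.Quotient.functor I.rel).obj (pathVertex k x) ⟶
      (CategoryTheory.Quotient.functor I.rel).obj (pathVertex k y)) := hy
    exact bot_ne_top h'
  obtain ⟨_, p, hp, -⟩ := h
  exact ⟨⟨_, p⟩, hp, rfl⟩

end LinearIdeal

end PathCategory

/-! ### Restriction to finitely presented modules -/

section Restriction

open RightMod

variable {k : Type w} [CommRing k]

lemma RightMod.isFinPres_of_iso {C : Type u} [Category.{w} C] [Preadditive C] [Linear k C]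
    {M N : RightMod k C} (e : M ≅ N) (hM : isFinPres k C M) : isFinPres k C N := by
  obtain ⟨m, n, Z, Y, d, p, h⟩ := hM
  refine ⟨m, n, Z, Y, d, p ≫ e.hom, fun X => ?_⟩
  let e' : M.obj.obj X ≃ₗ[k] N.obj.obj X :=
    (((isLinearFunctor k Cᵒᵖ (ModuleCat k)).ι.mapIso e).app X).toLinearEquiv
  refine ⟨fun y => ?_, e'.surjective.comp (h X).2⟩
  exact (e'.map_eq_zero_iff (x := (p.hom.app X).hom y)).trans ((h X).1 y)

lemma RightMod.isZero_iff {C : Type u} [Category.{w} C] [Preadditive C] [Linear k C]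
    (M : RightMod k C) : IsZero M ↔ ∀ X, Subsingleton (M.obj.obj X) := by
  constructor
  · intro h X
    refine subsingleton_of_forall_eq 0 fun m => ?_
    exact congrArg (fun z : M ⟶ M => (z.hom.app X).hom m) (h.eq_of_src (𝟙 M) 0)
  · intro h
    refine (IsZero.iff_id_eq_zero M).2 (ObjectProperty.hom_ext _ (NatTrans.ext (funext fun X =>
      ModuleCat.hom_ext (LinearMap.ext fun m => (h X).elim _ _))))

lemma isZero_fullSubcategory_iff {D : Type u} [Category.{v} D] [Preadditive D]
    {P : ObjectProperty D} (X : P.FullSubcategory) : IsZero X ↔ IsZero X.obj := by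
  rw [IsZero.iff_id_eq_zero, IsZero.iff_id_eq_zero]
  exact ⟨fun h => congrArg (fun z => z.hom) h, fun h => ObjectProperty.hom_ext _ h⟩

variable {B : Type u} [Category.{v} B] [Preadditive B] [Linear k B]
    {D : Type u'} [Category.{v'} D] [Preadditive D] [Linear k D]

/-- A representation in `D` whose values satisfy `P`, as a representation in `P`. -/
def LinFun.liftProperty (P : ObjectProperty D) (R : LinFun k B D) (hR : ∀ x, P (R.obj.obj x)) :
    LinFun k B P.FullSubcategory where
  obj := P.lift R.obj hR
  property := by
    have := R.property.1
    have := R.property.2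
    exact ⟨⟨fun {_ _ _ _} => ObjectProperty.hom_ext _ R.obj.map_add⟩,
      ⟨fun f r => ObjectProperty.hom_ext _ (R.obj.map_smul r f)⟩⟩

instance (P : ObjectProperty D) : (LinFun.postcompInclusion k B P).Faithful where
  map_injective h := by
    refine ObjectProperty.hom_ext _ (NatTrans.ext (funext fun x => ObjectProperty.hom_ext _ ?_))
    exact congrArg (fun z => z.hom.app x) h

instance (P : ObjectProperty D) : (LinFun.postcompInclusion k B P).Full where
  map_surjective ψ :=
    ⟨ObjectProperty.homMk
      { app := fun x => ObjectProperty.homMk (ψ.hom.app x)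
        naturality := fun _ _ f => ObjectProperty.hom_ext _ (ψ.hom.naturality f) }, rfl⟩

end Restriction

section Support

open RightMod

variable {k : Type w} [CommRing k] {Q : Type w} [Quiver.{w} Q]
  {I : LinearIdeal k (PathCat k Q)}
  {A : Type u} [Category.{w} A] [Preadditive A] [Linear k A]

instance : (supportFiniteRepInclusion I A).Faithful :=
  inferInstanceAs (_ ⋙ _).Faithful

instance : (supportFiniteRepInclusion I A).Full :=
  inferInstanceAs (_ ⋙ _).Full

lemma isFinPres_compareFunctor_obj (hQ : IsLocallyFiniteQuiver Q) (hI : I.IsAdmissible)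
    (R : SupportFiniteRep I (FinPresMod k A)) :
    isFinPres k _ ((supportFiniteRepInclusion I A ⋙ compareFunctor k I.Residue A).obj R) := by
  have hB : ∀ y : I.Residueᵒᵖ, {x : I.Residueᵒᵖ | Nontrivial (x ⟶ y)}.Finite := fun y =>
    ((LinearIdeal.finite_setOf_nontrivial_residue_hom hQ hI y.unop).image op).subset fun x hx =>
      ⟨x.unop, (opEquiv x y).nontrivial_congr.1 hx, rfl⟩
  refine LinFun.isFinPres_compareObj (LinearIdeal.finite_residue_op_hom hQ hI) hB
    (R := (supportFiniteRepInclusion I A).obj R) (fun v => (R.obj.obj.obj v).property)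
    (R.property.image fun x => op (I.vertex x)) fun v hv => ?_
  refine (RightMod.isZero_iff _).1 ((isZero_fullSubcategory_iff _).1 ?_ :
    IsZero (R.obj.obj.obj v.unop).obj)
  by_contra h
  exact hv ⟨v.unop.as, h, rfl⟩

lemma exists_supportFiniteRep [IsNoetherianRing k] (hQ : IsLocallyFiniteQuiver Q)
    (hI : I.IsAdmissible) (R : LinFun k I.Residue (RightMod k A))
    (hR : isFinPres k _ ((compareFunctor k I.Residue A).obj R)) :
    ∃ R' : SupportFiniteRep I (FinPresMod k A), (supportFiniteRepInclusion I A).obj R' = R := by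
  refine ⟨⟨LinFun.liftProperty (isFinPres k A) R
    (LinFun.isFinPres_obj (LinearIdeal.finite_residue_op_hom hQ hI) hR), ?_⟩, rfl⟩
  obtain ⟨n, Y, x, hx, -⟩ := (isFinPres_iff _).1 hR
  have hfin : {x : I.Residue | ∃ i, Nontrivial ((Y i).fst.unop ⟶ x)}.Finite := by
    rw [Set.ofPred_exists]
    exact Set.finite_iUnion fun i => LinearIdeal.finite_setOf_nontrivial_residue_hom hQ hI _
  refine (hfin.image fun y : I.Residue => (y.as : Q)).subset fun y hy => ⟨I.vertex y, ?_, rfl⟩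
  by_contra h
  refine hy ((isZero_fullSubcategory_iff _).2 ((RightMod.isZero_iff _).2 fun X => ?_))
  refine subsingleton_of_forall_eq 0 fun m => ?_
  obtain ⟨f, hf⟩ := hx ⟨op (I.vertex y), X.unop⟩ m
  refine hf.symm.trans (Finset.sum_eq_zero fun i _ => ?_)
  have : Subsingleton (op (I.vertex y) ⟶ (Y i).fst) := by
    rw [← not_nontrivial_iff_subsingleton]
    exact fun hn => h ⟨i, (opEquiv _ _).nontrivial_congr.1 hn⟩
  have : Subsingleton ((⟨op (I.vertex y), X.unop⟩ : TensorCat k I.Residueᵒᵖ A) ⟶ Y i) :=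
    TensorCat.subsingleton_hom this
  rw [Subsingleton.elim (f i) 0, map_zero, LinearMap.zero_apply]

/-- The restriction of `Φ` to a functor `rep(kQ / I, mod A) ⥤ mod((kQ / I)ᵒᵖ ⊗_k A)`. -/
def compareFinPres (hQ : IsLocallyFiniteQuiver Q) (hI : I.IsAdmissible) :
    SupportFiniteRep I (FinPresMod k A) ⥤ FinPresMod k (TensorCat k I.Residueᵒᵖ A) :=
  (isFinPres k (TensorCat k I.Residueᵒᵖ A)).lift
    (supportFiniteRepInclusion I A ⋙ compareFunctor k I.Residue A)
    (isFinPres_compareFunctor_obj hQ hI)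

lemma compareFinPres_isEquivalence [IsNoetherianRing k] (hQ : IsLocallyFiniteQuiver Q)
    (hI : I.IsAdmissible) : (compareFinPres hQ hI (A := A)).IsEquivalence where
  faithful := inferInstanceAs (ObjectProperty.lift _ _ _).Faithful
  full := inferInstanceAs (ObjectProperty.lift _ _ _).Full
  essSurj :=
    { mem_essImage := fun N => by
        let R := (compareFunctor k I.Residue A).objPreimage N.obj
        let e : (compareFunctor k I.Residue A).obj R ≅ N.obj :=
          (compareFunctor k I.Residue A).objObjPreimageIso N.obj
        obtain ⟨R', hR'⟩ := exists_supportFiniteRep hQ hI R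
          (RightMod.isFinPres_of_iso e.symm N.property)
        exact ⟨R', ⟨ObjectProperty.isoMk _
          ((compareFunctor k I.Residue A).mapIso (eqToIso hR') ≪≫ e)⟩⟩ }

end Support

end

theorem proposition1 {k : Type w} [CommRing k] [IsArtinianRing k]
    {Q : Type w} [Quiver.{w} Q] (hQ : IsLocallyFiniteQuiver Q)
    (I : LinearIdeal k (PathCat k Q)) (hI : I.IsAdmissible) (hIp : I.IsGeneratedByPaths)
    {A : Type u} [Category.{w} A] [Preadditive A] [Linear k A] [HasFiniteBiproducts A]
    [EssentiallySmall.{w} A] (hA : HasPseudoKernels A) :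
    (compareFunctor k I.Residue A).IsEquivalence ∧
      ∃ e : SupportFiniteRep I (FinPresMod k A) ≌ FinPresMod k (TensorCat k I.Residueᵒᵖ A),
        Nonempty (e.functor ⋙ (isFinPres k (TensorCat k I.Residueᵒᵖ A)).ι ≅
          supportFiniteRepInclusion I A ⋙ compareFunctor k I.Residue A) := by
  have := compareFinPres_isEquivalence (A := A) hQ hI
  exact ⟨inferInstance, (compareFinPres hQ hI).asEquivalence, ⟨Iso.refl _⟩⟩
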